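/- Let $d\in\{2,3\}$, let $\Omega\subset\mathbb R^d$ be a polyhedral domain (bounded, and equal to the interior of its closure), and let $\mathcal T_h$ be a conforming simplicial mesh of $\Omega$ with set of faces $\mathcal F_h=\mathcal F_h^i\cup\mathcal F_h^\partial$ (interior faces, shared by two elements, and boundary faces, contained in one element). On each interior face $F$ fix a unit normal $n_F$ pointing from one adjacent element $K^+$ to the other one $K^-$, and put $[\![\phi]\!]=\phi|_{K^+}-\phi|_{K^-}$, $\{\!\!\{\phi\}\!\!\}=\frac12(\phi|_{K^+}+\phi|_{K^-})$; on a boundary face of an element $K$ let $n_F$ be the outward unit normal and $[\![\phi]\!]=\{\!\!\{\phi\}\!\!\}=\phi|_K$. Write $n|_F=n_F$. Let $(\cdot,\cdot)$ be the $L^2(\Omega)$ inner product, $\langle\cdot,\cdot\rangle_F$ the $L^2(F)$ inner product, $\langle\cdot,\cdot\rangle_{\mathcal F_h}=\sum_{F\in\mathcal F_h}\langle\cdot,\cdot\rangle_F$, $\langle\cdot,\cdot\rangle_{\mathcal F_h^i}=\sum_{F\in\mathcal F_h^i}\langle\cdot,\cdot\rangle_F$, and $\nabla_h$ the elementwise gradient.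 Let $k\ge 0$ be an integer and $$V_h=\{v\in[L^2(\Omega)]^d: v|_K\in[\mathcal P_{k+1}(K)]^d\ \ \forall K\in\mathcal T_h\},$$ $$V_h^{\mathrm{div}}=\{v\in H(\mathrm{div};\Omega): v|_K\in\mathcal Q_k(K)\ \ \forall K\in\mathcal T_h,\ v\cdot n|_{\partial\Omega}=0\},$$ where $\mathcal P_j(K)$ is the space of polynomials of degree at most $j$ and either $\mathcal Q_k(K)=[\mathcal P_k(K)]^d+\mathcal P_k(K)x$ for all $K$ (Raviart--Thomas) or $\mathcal Q_k(K)=[\mathcal P_{k+1}(K)]^d$ for all $K$ (Brezzi--Douglas--Marini). Let $\theta\in\mathbb R$ and let $\zeta=\{\zeta_F\}_{F\in\mathcal F_h}$ be non-negative constants. Define \begin{align*} c_h^1(u;u,v)={}&(u\cdot\nabla_h u,v)+\tfrac12((\nabla_h\cdot u)u,v)-\langle(\{\!\!\{u\}\!\!\}\cdot n)[\![u]\!],\{\!\!\{v\}\!\!\}\rangle_{\mathcal F_h^i}-\tfrac12\langle[\![u]\!]\cdot n,\{\!\!\{u\cdot v\}\!\!\}\rangle_{\mathcal F_h^i}\\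 &+\langle\zeta|\{\!\!\{u\}\!\!\}\cdot n|[\![u]\!],[\![v]\!]\rangle_{\mathcal F_h}+\theta\langle(\{\!\!\{v\}\!\!\}\cdot n)[\![u]\!],\{\!\!\{u\}\!\!\}\rangle_{\mathcal F_h^i}+\tfrac\theta2\langle[\![v]\!]\cdot n,\{\!\!\{u\cdot u\}\!\!\}\rangle_{\mathcal F_h^i}\\ &-\theta(v\cdot\nabla_h u,u)-\tfrac\theta2((\nabla_h\cdot v)u,u),\\ c_h^2(u;u,v)={}&(u\cdot\nabla_h u,v)+\tfrac{1-\theta}2((\nabla_h\cdot u)u,v)-\langle(\{\!\!\{u\}\!\!\}\cdot n)[\![u]\!],\{\!\!\{v\}\!\!\}\rangle_{\mathcal F_h^i}-\tfrac{1-\theta}2\langle[\![u]\!]\cdot n,\{\!\!\{u\cdot v\}\!\!\}\rangle_{\mathcal F_h^i}\\ &+\langle\zeta|\{\!\!\{u\}\!\!\}\cdot n|[\![u]\!],[\![v]\!]\rangle_{\mathcal F_h}+\theta\langle(\{\!\!\{v\}\!\!\}\cdot n)[\![u]\!],\{\!\!\{u\}\!\!\}\rangle_{\mathcal F_h^i}-\theta(v\cdot\nabla_h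 u,u). \end{align*} (a) If $\zeta_F\ge\frac12|1-\theta|$ for all $F\in\mathcal F_h^\partial$, then $c_h^1(v_h;v_h,v_h)=c_h^2(v_h;v_h,v_h)\ge0$ for every $v_h\in V_h$. (b) For arbitrary non-negative $\zeta_F$, $F\in\mathcal F_h$, one has $c_h^1(v_h;v_h,v_h)=c_h^2(v_h;v_h,v_h)\ge0$ for every $v_h\in V_h^{\mathrm{div}}$. -/

import Mathlib

open MeasureTheory

/-- Euclidean space `ℝ^d`. -/
abbrev Euc (d : ℕ) : Type := EuclideanSpace ℝ (Fin d)

noncomputable section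

namespace DG

/-! ### Domains and meshes -/

/-- A polyhedral domain: an open connected set which is the interior of its closure (no slits),
and whose closure is a finite union of convex polytopes. In particular it is bounded. -/
structure IsPolyhedralDomain {d : ℕ} (Ω : Set (Euc d)) : Prop where
  isOpen : IsOpen Ω
  isConnected : IsConnected Ω
  interior_closure : interior (closure Ω) = Ω
  polyhedral : ∃ P : Finset (Finset (Euc d)),
    closure Ω = ⋃ s ∈ P, convexHull ℝ (s : Set (Euc d))

/-- A conforming simplicial mesh of `Ω`: a finite simplicial complex, all of whose maximal
simplices are `d`-dimensional, which fills the closure of `Ω`. Simplices are recorded through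
their finite sets of vertices; the geometric simplex is the convex hull. -/
structure Mesh {d : ℕ} (Ω : Set (Euc d)) extends Geometry.SimplicialComplex ℝ (Euc d) where
  finite_faces : faces.Finite
  pure_dim : ∀ s ∈ faces, ∃ K ∈ faces, s ⊆ K ∧ K.card = d + 1
  space_eq : (⋃ s ∈ faces, convexHull ℝ (s : Set (Euc d))) = closure Ω

open Classical in
/-- The elements `K ∈ 𝒯_h`: the `d`-simplices of the mesh. -/
def Mesh.cells {d : ℕ} {Ω : Set (Euc d)} (T : Mesh Ω) : Finset (Finset (Euc d)) :=
  T.finite_faces.toFinset.filter fun K => K.card = d + 1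

open Classical in
/-- The faces `F ∈ 𝓕_h`: the `(d-1)`-simplices of the mesh. -/
def Mesh.skel {d : ℕ} {Ω : Set (Euc d)} (T : Mesh Ω) : Finset (Finset (Euc d)) :=
  T.finite_faces.toFinset.filter fun F => F.card = d

open Classical in
/-- The interior faces `𝓕_h^i`: those shared by two distinct elements. -/
def Mesh.intFaces {d : ℕ} {Ω : Set (Euc d)} (T : Mesh Ω) : Finset (Finset (Euc d)) :=
  T.skel.filter fun F => ∃ K ∈ T.cells, ∃ L ∈ T.cells, K ≠ L ∧ F ⊆ K ∧ F ⊆ L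

open Classical in
/-- The boundary faces `𝓕_h^∂`: those contained in a single element. -/
def Mesh.bdryFaces {d : ℕ} {Ω : Set (Euc d)} (T : Mesh Ω) : Finset (Finset (Euc d)) :=
  T.skel.filter fun F => ∃! K, K ∈ T.cells ∧ F ⊆ K

/-- A choice of unit normals `n_F` on the faces. On an interior face `n_F` points from `K⁺` to the
other element `K⁻`. On a boundary face `K⁺` is the only element containing `F`, so that `n_F` is
the outward normal to `∂Ω`. (The value of `minus` on boundary faces is irrelevant.) -/
structure FaceNormals {d : ℕ} {Ω : Set (Euc d)} (T : Mesh Ω) where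
  plus : Finset (Euc d) → Finset (Euc d)
  minus : Finset (Euc d) → Finset (Euc d)
  normal : Finset (Euc d) → Euc d
  plus_mem : ∀ F ∈ T.skel, plus F ∈ T.cells ∧ F ⊆ plus F
  minus_mem : ∀ F ∈ T.intFaces, minus F ∈ T.cells ∧ F ⊆ minus F ∧ minus F ≠ plus F
  norm_normal : ∀ F ∈ T.skel, ‖normal F‖ = 1
  normal_orthogonal : ∀ F ∈ T.skel, ∀ x ∈ F, ∀ y ∈ F, inner ℝ (normal F) (y - x) = 0
  normal_outward : ∀ F ∈ T.skel, ∀ x ∈ F, ∀ a ∈ plus F, a ∉ F → inner ℝ (normal F) (a - x) < 0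

/-! ### Finite element spaces -/

/-- Vector fields in `[𝒫_j]^d`: every component is a polynomial of total degree at most `j`. -/
def IsVecPoly {d : ℕ} (j : ℕ) (f : Euc d → Euc d) : Prop :=
  ∃ p : Fin d → MvPolynomial (Fin d) ℝ, (∀ i, (p i).totalDegree ≤ j) ∧
    ∀ x i, f x i = MvPolynomial.eval (fun l => x l) (p i)

/-- Vector fields in `[𝒫_k]^d + 𝒫_k x`. -/
def IsRaviartThomas {d : ℕ} (k : ℕ) (f : Euc d → Euc d) : Prop :=
  ∃ (p : Fin d → MvPolynomial (Fin d) ℝ) (q : MvPolynomial (Fin d) ℝ),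
    (∀ i, (p i).totalDegree ≤ k) ∧ q.totalDegree ≤ k ∧
    ∀ x i, f x i =
      MvPolynomial.eval (fun l => x l) (p i) + MvPolynomial.eval (fun l => x l) q * x i

/-- The two choices of `H(div)` elements. -/
inductive Family where
  | RT : Family
  | BDM : Family

/-- The shape function space `𝓠_k`: `[𝒫_k]^d + 𝒫_k x` for RT, `[𝒫_{k+1}]^d` for BDM. -/
def Family.IsShape {d : ℕ} (fam : Family) (k : ℕ) (f : Euc d → Euc d) : Prop :=
  match fam with
  | Family.RT => IsRaviartThomas k f
  | Family.BDM => IsVecPoly (k + 1) f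

/-- `v|_K = f` for (classes of) functions on `Ω`: equality almost everywhere on `K`. -/
def EqOnCell {d : ℕ} (K : Finset (Euc d)) (v f : Euc d → Euc d) : Prop :=
  v =ᵐ[volume.restrict (convexHull ℝ (K : Set (Euc d)))] f

/-- The broken polynomial space `V_h ⊆ [L²(Ω)]^d` of piecewise `[𝒫_{k+1}]^d` fields. -/
def Vh {d : ℕ} {Ω : Set (Euc d)} (T : Mesh Ω) (k : ℕ) : Set (Euc d → Euc d) :=
  {v | MemLp v 2 (volume.restrict Ω) ∧
    ∀ K ∈ T.cells, ∃ f, IsVecPoly (k + 1) f ∧ EqOnCell K v f}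

open Classical in
/-- The polynomial vector field which `v` equals almost everywhere on the element `K` (unique, as
`K` has positive measure). It carries the traces of `v|_K` on the faces of `K` and the derivatives
of `v|_K`. Where `v` is not piecewise polynomial the value is `0`. -/
def piece {d : ℕ} (v : Euc d → Euc d) (K : Finset (Euc d)) : Euc d → Euc d :=
  if h : ∃ f, (∃ j, IsVecPoly j f) ∧ EqOnCell K v f then h.choose else 0

/-- `H(div; Ω)`: square integrable fields with a square integrable weak divergence. -/
def HDiv {d : ℕ} (Ω : Set (Euc d)) : Set (Euc d → Euc d) :=
  {v | MemLp v 2 (volume.restrict Ω) ∧ ∃ g : Euc d → ℝ, MemLp g 2 (volume.restrict Ω) ∧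
    ∀ φ : Euc d → ℝ, ContDiff ℝ (⊤ : ℕ∞) φ → HasCompactSupport φ → tsupport φ ⊆ Ω →
      ∫ x in Ω, fderiv ℝ φ x (v x) = - ∫ x in Ω, g x * φ x}

/-- The `H(div)`-conforming space `V_h^div`, with `v · n = 0` on `∂Ω`. -/
def VhDiv {d : ℕ} {Ω : Set (Euc d)} (T : Mesh Ω) (N : FaceNormals T) (fam : Family) (k : ℕ) :
    Set (Euc d → Euc d) :=
  {v | v ∈ HDiv Ω ∧ (∀ K ∈ T.cells, ∃ f, fam.IsShape k f ∧ EqOnCell K v f) ∧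
    ∀ F ∈ T.bdryFaces, ∀ x ∈ convexHull ℝ (F : Set (Euc d)),
      inner ℝ (piece v (N.plus F) x) (N.normal F) = 0}

/-! ### Jumps, averages and inner products

A broken function is a family `φ K : ℝ^d → X` indexed by the elements; `φ K` stands for `φ|_K`. -/

open Classical in
/-- The jump `⟦φ⟧` on the face `F`. -/
def jump {d : ℕ} {Ω : Set (Euc d)} {T : Mesh Ω} (N : FaceNormals T) {X : Type} [AddCommGroup X]
    (φ : Finset (Euc d) → Euc d → X) (F : Finset (Euc d)) (x : Euc d) : X :=
  if F ∈ T.intFaces then φ (N.plus F) x - φ (N.minus F) x else φ (N.plus F) x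

open Classical in
/-- The average `{{φ}}` on the face `F`. -/
def avg {d : ℕ} {Ω : Set (Euc d)} {T : Mesh Ω} (N : FaceNormals T) {X : Type} [AddCommGroup X]
    [Module ℝ X] (φ : Finset (Euc d) → Euc d → X) (F : Finset (Euc d)) (x : Euc d) : X :=
  if F ∈ T.intFaces then (1 / 2 : ℝ) • (φ (N.plus F) x + φ (N.minus F) x) else φ (N.plus F) x

/-- The `L²` inner product on a face, with respect to the surface measure. -/
def faceInner {d : ℕ} {X : Type} [NormedAddCommGroup X] [InnerProductSpace ℝ X]
    (F : Finset (Euc d)) (f g : Euc d → X) : ℝ :=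
  ∫ x in convexHull ℝ (F : Set (Euc d)), inner ℝ (f x) (g x) ∂μHE[d - 1]

/-- The `L²(Ω)` inner product of two broken functions. -/
def cellInner {d : ℕ} {Ω : Set (Euc d)} (T : Mesh Ω) {X : Type} [NormedAddCommGroup X]
    [InnerProductSpace ℝ X] (f g : Finset (Euc d) → Euc d → X) : ℝ :=
  ∑ K ∈ T.cells, ∫ x in convexHull ℝ (K : Set (Euc d)), inner ℝ (f K x) (g K x)

/-- The divergence `∑ i, ∂_i β_i`. -/
def divergence {d : ℕ} (β : Euc d → Euc d) (x : Euc d) : ℝ :=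
  ∑ i, (fderiv ℝ β x (EuclideanSpace.single i 1)) i

/-! ### The convective forms -/

/-- `(β · ∇_h v, w)`, where `(β · ∇v)_i = ∑ j, β_j ∂_j v_i`. -/
def convTerm {d : ℕ} {Ω : Set (Euc d)} (T : Mesh Ω) (β v w : Euc d → Euc d) : ℝ :=
  cellInner T (fun K x => fderiv ℝ (piece v K) x (piece β K x)) (piece w)

/-- `((∇_h · β) v, w)`. -/
def divTerm {d : ℕ} {Ω : Set (Euc d)} (T : Mesh Ω) (β v w : Euc d → Euc d) : ℝ :=
  cellInner T (fun K x => divergence (piece β K) x • piece v K x) (piece w)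

/-- `⟨({{β}} · n) ⟦v⟧, {{w}}⟩` over the interior faces. -/
def fluxTerm {d : ℕ} {Ω : Set (Euc d)} {T : Mesh Ω} (N : FaceNormals T)
    (β v w : Euc d → Euc d) : ℝ :=
  ∑ F ∈ T.intFaces, faceInner F
    (fun x => inner ℝ (avg N (piece β) F x) (N.normal F) • jump N (piece v) F x)
    (avg N (piece w) F)

/-- `⟨⟦β⟧ · n, {{v · w}}⟩` over the interior faces. -/
def jumpTerm {d : ℕ} {Ω : Set (Euc d)} {T : Mesh Ω} (N : FaceNormals T)
    (β v w : Euc d → Euc d) : ℝ :=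
  ∑ F ∈ T.intFaces, faceInner F
    (fun x => inner ℝ (jump N (piece β) F x) (N.normal F))
    (avg N (fun K x => inner ℝ (piece v K x) (piece w K x)) F)

/-- `⟨ζ |{{β}} · n| ⟦v⟧, ⟦w⟧⟩` over all faces. -/
def upwindTerm {d : ℕ} {Ω : Set (Euc d)} {T : Mesh Ω} (N : FaceNormals T)
    (ζ : Finset (Euc d) → ℝ) (β v w : Euc d → Euc d) : ℝ :=
  ∑ F ∈ T.skel, faceInner F
    (fun x => (ζ F * |inner ℝ (avg N (piece β) F x) (N.normal F)|) • jump N (piece v) F x)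
    (jump N (piece w) F)

/-- The form `c_h^1(u; u, v)`. -/
def c1 {d : ℕ} {Ω : Set (Euc d)} (T : Mesh Ω) (N : FaceNormals T) (ζ : Finset (Euc d) → ℝ)
    (θ : ℝ) (u v : Euc d → Euc d) : ℝ :=
  convTerm T u u v + 1 / 2 * divTerm T u u v - fluxTerm N u u v
    - 1 / 2 * jumpTerm N u u v + upwindTerm N ζ u u v + θ * fluxTerm N v u u
    + θ / 2 * jumpTerm N v u u - θ * convTerm T v u u - θ / 2 * divTerm T v u u

/-- The form `c_h^2(u; u, v)`. -/
def c2 {d : ℕ} {Ω : Set (Euc d)} (T : Mesh Ω) (N : FaceNormals T) (ζ : Finset (Euc d) → ℝ)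
    (θ : ℝ) (u v : Euc d → Euc d) : ℝ :=
  convTerm T u u v + (1 - θ) / 2 * divTerm T u u v - fluxTerm N u u v
    - (1 - θ) / 2 * jumpTerm N u u v + upwindTerm N ζ u u v
    + θ * fluxTerm N v u u - θ * convTerm T v u u

end DG

end

noncomputable section

namespace DG

/-! ### Parametrized simplices -/

/-! For equal arguments the `θ`-terms repeat the others with factor `-θ`. Both forms then equal `(1
- θ)` times (convection + ½ divergence - flux - ½ jump), plus the upwind term.

The bracket reduces to boundary fluxes. On a cell, `div(|v|²v) = 2((v·∇v)·v + ½|v|² div v)`, so by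
the divergence theorem the volume terms are half the outward flux of `|v|²v`. Sorted by faces
(`FaceNormals.sum_cells_faces`), these fluxes give `½(|v⁺|²v⁺·n - |v⁻|²v⁻·n)` on each interior face,
and this is pointwise the flux term plus half the jump term. What is left (`c2_self`) is `(1 - θ)/2`
times the flux of `|v|²v` through the boundary faces, plus the non-negative upwind term. In (b) the
flux is zero because `v·n = 0`; in (a) the upwind term on the boundary dominates it as soon as `ζ ≥
½|1 - θ|`.

The work lies in two geometric facts. One is the divergence theorem on a simplex with Hausdorff
measure on the facets (`integral_divergence_simplex`): the fundamental theorem of calculus along one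
edge, then linearity, since the edges span. The other is that a face of the mesh has at most one
cell on each side (`Mesh.opposite_eq_of_same_side`), which identifies the cells around a face and
the sign of `n_F` for each. -/

/-- The corner simplex `{y ≥ 0, ∑ y ≤ 1}` of `ℝ^m`. -/
def cornerSimplex (m : ℕ) : Set (Fin m → ℝ) := {y | (∀ i, 0 ≤ y i) ∧ ∑ i, y i ≤ 1}

theorem isClosed_cornerSimplex (m : ℕ) : IsClosed (cornerSimplex m) := by
  refine IsClosed.and ?_ ?_
  · simp only [Set.ofPred_forall]
    exact isClosed_iInter fun i => isClosed_le continuous_const (continuous_apply i)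
  · exact isClosed_le (by fun_prop) continuous_const

theorem isCompact_cornerSimplex (m : ℕ) : IsCompact (cornerSimplex m) := by
  refine (isCompact_Icc (a := (0 : Fin m → ℝ)) (b := 1)).of_isClosed_subset
    (isClosed_cornerSimplex m) fun y hy => ⟨hy.1, fun i => ?_⟩
  exact (Finset.single_le_sum (fun j _ => hy.1 j) (Finset.mem_univ i)).trans hy.2

/-- The affine parametrization of the simplex with vertices `q` over the corner simplex. -/
def simplexParam {m : ℕ} {E : Type*} [AddCommGroup E] [Module ℝ E] (q : Fin (m + 1) → E)
    (y : Fin m → ℝ) : E :=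
  q 0 + ∑ j, y j • (q j.succ - q 0)

theorem image_simplexParam {m : ℕ} {E : Type*} [AddCommGroup E] [Module ℝ E]
    (q : Fin (m + 1) → E) :
    simplexParam q '' cornerSimplex m = convexHull ℝ (Set.range q) := by
  apply Set.Subset.antisymm
  · rintro _ ⟨y, hy, rfl⟩
    -- The barycentric weights are the `y j`, with the remainder `1 - ∑ y` on `q 0`.
    have h : simplexParam q y = ∑ i, (Fin.cons (1 - ∑ j, y j) y : Fin (m + 1) → ℝ) i • q i := by
      simp only [simplexParam, Fin.sum_univ_succ, Fin.cons_zero, Fin.cons_succ, smul_sub,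
        Finset.sum_sub_distrib, ← Finset.sum_smul]
      module
    rw [h]
    refine (convex_convexHull ℝ _).sum_mem (fun i _ => ?_) ?_
      fun i _ => subset_convexHull ℝ _ ⟨i, rfl⟩
    · refine Fin.cases ?_ (fun j => ?_) i
      · simpa using hy.2
      · simpa using hy.1 j
    · simp [Fin.sum_univ_succ]
  · refine convexHull_min ?_ ?_
    · rintro _ ⟨i, rfl⟩
      refine Fin.cases ?_ (fun j => ?_) i
      · exact ⟨0, ⟨fun _ => le_rfl, by simp⟩, by simp [simplexParam]⟩
      · refine ⟨Pi.single j 1, ⟨fun i => ?_, by simp⟩, by simp [simplexParam, Pi.single_apply]⟩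
        by_cases h : i = j
        · subst h; simp
        · simp [h]
    · rintro _ ⟨x, hx, rfl⟩ _ ⟨y, hy, rfl⟩ s t hs ht hst
      refine ⟨s • x + t • y, ⟨fun i => ?_, ?_⟩, ?_⟩
      · have h1 := hx.1 i
        have h2 := hy.1 i
        simp only [Pi.add_apply, Pi.smul_apply, smul_eq_mul]
        positivity
      · simp only [Pi.add_apply, Pi.smul_apply, smul_eq_mul, Finset.sum_add_distrib,
          ← Finset.mul_sum]
        nlinarith [hx.2, hy.2]
      · simp only [simplexParam, Pi.add_apply, Pi.smul_apply, smul_eq_mul, add_smul, mul_smul,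
          Finset.sum_add_distrib, ← Finset.smul_sum, smul_add]
        have : q 0 = (s + t) • q 0 := by rw [hst, one_smul]
        nth_rewrite 1 [this]
        module

/-- The change of basis between two orthonormal bases has determinant `±1`. -/
theorem abs_det_inner_orthonormalBasis {d : ℕ} (β γ : OrthonormalBasis (Fin d) ℝ (Euc d))
    (v : Fin d → Euc d) :
    |(Matrix.of fun i j => inner ℝ (β i) (v j)).det| =
      |(Matrix.of fun i j => inner ℝ (γ i) (v j)).det| := by
  have h : (Matrix.of fun i j => inner ℝ (β i) (v j)) =
      β.toBasis.toMatrix γ * (Matrix.of fun i j => inner ℝ (γ i) (v j)) := by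
    ext i j
    simp only [Matrix.mul_apply, Matrix.of_apply, Module.Basis.toMatrix_apply,
      OrthonormalBasis.coe_toBasis_repr_apply, OrthonormalBasis.repr_apply_apply]
    exact (γ.sum_inner_mul_inner (β i) (v j)).symm
  rw [h, Matrix.det_mul, abs_mul]
  have h1 : |(β.toBasis.toMatrix γ).det| = 1 := by
    rcases β.det_to_matrix_orthonormalBasis_real γ with h | h <;>
      rw [Module.Basis.det_apply] at h <;> simp [h]
  rw [h1, one_mul]

/-- Since the `v j` lie in the span of `b`, a kernel vector of the coordinate matrix would be a
linear relation among them. -/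
theorem det_inner_ne_zero {m d : ℕ} {b v : Fin m → Euc d}
    (hv : LinearIndependent ℝ v) (hbv : ∀ j, v j = ∑ i, inner ℝ (b i) (v j) • b i) :
    (Matrix.of fun i j => inner ℝ (b i) (v j)).det ≠ 0 := by
  intro h
  obtain ⟨y, hy, hMy⟩ := Matrix.exists_mulVec_eq_zero_iff.mpr h
  apply hy
  funext j
  refine Fintype.linearIndependent_iff.mp hv y ?_ j
  calc ∑ j, y j • v j = ∑ i, (∑ j, inner ℝ (b i) (v j) * y j) • b i := by
        simp_rw [Finset.sum_smul]
        rw [Finset.sum_comm]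
        refine Finset.sum_congr rfl fun j _ => ?_
        conv_lhs => rw [hbv j, Finset.smul_sum]
        exact Finset.sum_congr rfl fun i _ => by rw [smul_smul, mul_comm]
    _ = 0 := by
        refine Finset.sum_eq_zero fun i _ => ?_
        have := congrFun hMy i
        simp only [Matrix.mulVec, dotProduct, Matrix.of_apply, Pi.zero_apply] at this
        rw [this, zero_smul]

theorem linearIndependent_sub_zero {m d : ℕ} {q : Fin (m + 1) → Euc d}
    (hq : AffineIndependent ℝ q) : LinearIndependent ℝ fun j : Fin m => q j.succ - q 0 := by
  have h := (affineIndependent_iff_linearIndependent_vsub ℝ q 0).mp hq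
  exact h.comp (fun j : Fin m => (⟨j.succ, Fin.succ_ne_zero j⟩ : {x : Fin (m + 1) // x ≠ 0}))
    fun i j hij => by simpa using hij

/-- The surface measure of a simplex in the affine parametrization. -/
theorem map_simplexParam {m d : ℕ} {b : Fin m → Euc d} (hb : Orthonormal ℝ b)
    {q : Fin (m + 1) → Euc d} (hq : AffineIndependent ℝ q)
    (hbq : ∀ j : Fin m, q j.succ - q 0 = ∑ i, inner ℝ (b i) (q j.succ - q 0) • b i) :
    MeasurableEmbedding (simplexParam q) ∧
    ∃ s : Set (Euc d), Set.range (simplexParam q) ⊆ s ∧ MeasurableSet s ∧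
    (volume : Measure (Fin m → ℝ)).map (simplexParam q) =
      ENNReal.ofReal |(Matrix.of fun i j : Fin m => inner ℝ (b i) (q j.succ - q 0)).det⁻¹| •
        (μHE[m] : Measure (Euc d)).restrict s := by
  set M : Matrix (Fin m) (Fin m) ℝ := Matrix.of fun i j => inner ℝ (b i) (q j.succ - q 0) with hM
  have hv := linearIndependent_sub_zero hq
  have hdet : M.det ≠ 0 := det_inner_ne_zero hv hbq
  -- The parametrization is the matrix `M`, followed by the passage to the Euclidean norm and the
  -- isometry `φ` onto the affine plane of the simplex. Only `M` distorts volume; `φ` carries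
  -- Lebesgue measure to `μHE[m]` on its range.
  let φ : EuclideanSpace ℝ (Fin m) → Euc d := fun y => q 0 + ∑ i, y i • b i
  have hφ : Isometry φ := by
    refine Isometry.of_dist_eq fun x y => ?_
    rw [dist_eq_norm, dist_eq_norm]
    have h1 : φ x - φ y = ∑ i, (x - y) i • b i := by
      simp only [φ, add_sub_add_left_eq_sub, ← Finset.sum_sub_distrib, PiLp.sub_apply, sub_smul]
    rw [h1, ← sq_eq_sq₀ (norm_nonneg _) (norm_nonneg _), ← real_inner_self_eq_norm_sq,
      hb.inner_sum, EuclideanSpace.norm_sq_eq]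
    simp [sq]
  have hcomp : simplexParam q = φ ∘ WithLp.toLp 2 ∘ Matrix.toLin' M := by
    funext y
    simp only [Function.comp_apply, φ, simplexParam, Matrix.toLin'_apply, Matrix.mulVec,
      dotProduct, hM, Matrix.of_apply, Finset.sum_smul]
    congr 1
    rw [Finset.sum_comm]
    refine Finset.sum_congr rfl fun j _ => ?_
    conv_lhs => rw [hbq j, Finset.smul_sum]
    exact Finset.sum_congr rfl fun i _ => by rw [smul_smul, mul_comm]
  have hinj : Function.Injective (Matrix.toLin' M) := by
    have : IsUnit M := (Matrix.isUnit_iff_isUnit_det _).mpr hdet.isUnit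
    exact Matrix.mulVec_injective_iff_isUnit.mpr this
  have hM1 : MeasurableEmbedding (Matrix.toLin' M) :=
    (LinearMap.isClosedEmbedding_of_injective
      (LinearMap.ker_eq_bot.mpr hinj)).measurableEmbedding
  have hL : MeasurableEmbedding (WithLp.toLp 2 : (Fin m → ℝ) → EuclideanSpace ℝ (Fin m)) :=
    (MeasurableEquiv.toLp 2 (Fin m → ℝ)).measurableEmbedding
  have hφ1 : MeasurableEmbedding φ := hφ.isClosedEmbedding.measurableEmbedding
  refine ⟨hcomp ▸ hφ1.comp (hL.comp hM1), Set.range φ, ?_, hφ1.measurableSet_range, ?_⟩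
  · rw [hcomp]; exact Set.range_comp_subset_range _ _
  · rw [hcomp, ← Measure.map_map hφ1.measurable (hL.comp hM1).measurable,
      ← Measure.map_map hL.measurable hM1.measurable,
      Real.map_matrix_volume_pi_eq_smul_volume_pi hdet, Measure.map_smul,
      (PiLp.volume_preserving_toLp (Fin m)).map_eq, Measure.map_smul,
      ← EuclideanSpace.euclideanHausdorffMeasure_eq_volume, hφ.map_euclideanHausdorffMeasure]

/-- Change of variables: the surface Jacobian is the determinant of the edge vectors in an
orthonormal frame of their span. -/
theorem setIntegral_simplex {m d : ℕ} {b : Fin m → Euc d} (hb : Orthonormal ℝ b)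
    {q : Fin (m + 1) → Euc d} (hq : AffineIndependent ℝ q)
    (hbq : ∀ j : Fin m, q j.succ - q 0 = ∑ i, inner ℝ (b i) (q j.succ - q 0) • b i)
    (f : Euc d → ℝ) :
    ∫ x in convexHull ℝ (Set.range q), f x ∂μHE[m] =
      |(Matrix.of fun i j : Fin m => inner ℝ (b i) (q j.succ - q 0)).det| *
        ∫ y in cornerSimplex m, f (simplexParam q y) := by
  obtain ⟨he, s, hs, hsm, hmap⟩ := map_simplexParam hb hq hbq
  have hv := linearIndependent_sub_zero hq
  have hdet := det_inner_ne_zero hv hbq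
  have h := he.setIntegral_map (μ := volume) f (convexHull ℝ (Set.range q))
  have hpre : simplexParam q ⁻¹' (convexHull ℝ (Set.range q)) = cornerSimplex m := by
    rw [← image_simplexParam, Set.preimage_image_eq _ he.injective]
  have hsub : convexHull ℝ (Set.range q) ⊆ s := by
    rw [← image_simplexParam]; exact (Set.image_subset_range _ _).trans hs
  rw [hpre, hmap, Measure.restrict_smul, Measure.restrict_restrict_of_subset hsub,
    integral_smul_measure, ENNReal.toReal_ofReal (abs_nonneg _), smul_eq_mul] at h
  rw [← h, ← mul_assoc, abs_inv, mul_inv_cancel₀ (abs_ne_zero.mpr hdet), one_mul]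

theorem euclideanHausdorffMeasure_simplex_lt_top {m d : ℕ} {b : Fin m → Euc d}
    (hb : Orthonormal ℝ b) {q : Fin (m + 1) → Euc d} (hq : AffineIndependent ℝ q)
    (hbq : ∀ j : Fin m, q j.succ - q 0 = ∑ i, inner ℝ (b i) (q j.succ - q 0) • b i) :
    (μHE[m] : Measure (Euc d)) (convexHull ℝ (Set.range q)) < ⊤ := by
  obtain ⟨he, s, hs, hsm, hmap⟩ := map_simplexParam hb hq hbq
  have hv := linearIndependent_sub_zero hq
  have hdet := det_inner_ne_zero hv hbq
  have hpre : simplexParam q ⁻¹' (convexHull ℝ (Set.range q)) = cornerSimplex m := by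
    rw [← image_simplexParam, Set.preimage_image_eq _ he.injective]
  have hsub : convexHull ℝ (Set.range q) ⊆ s := by
    rw [← image_simplexParam]; exact (Set.image_subset_range _ _).trans hs
  have hfin := (isCompact_cornerSimplex m).measure_lt_top (μ := volume)
  rw [← hpre, ← he.map_apply, hmap, Measure.smul_apply, Measure.restrict_apply' hsm,
    Set.inter_eq_left.mpr hsub, smul_eq_mul] at hfin
  refine ENNReal.lt_top_of_mul_ne_top_right hfin.ne ?_
  rw [Ne, ENNReal.ofReal_eq_zero, not_le]
  exact abs_pos.mpr (inv_ne_zero hdet)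

/-! ### The fundamental theorem of calculus on the corner simplex -/

/-- Fubini, then the fundamental theorem of calculus on each fibre `[0, 1 - ∑ y]` of the first
coordinate. The ends of the fibres sweep out the slanted facet and the facet `z 0 = 0`. -/
theorem integral_cornerSimplex_succ {m : ℕ} {G G' : ℝ → (Fin m → ℝ) → ℝ}
    (hG' : Continuous fun p : ℝ × (Fin m → ℝ) => G' p.1 p.2)
    (hG : ∀ t y, HasDerivAt (fun t => G t y) (G' t y) t) :
    ∫ z in cornerSimplex (m + 1), G' (z 0) (Fin.tail z) =
      ∫ y in cornerSimplex m, (G (1 - ∑ j, y j) y - G 0 y) := by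
  let e := MeasurableEquiv.piFinSuccAbove (fun _ : Fin (m + 1) => ℝ) 0
  have he : MeasurePreserving e :=
    volume_preserving_piFinSuccAbove (fun _ : Fin (m + 1) => ℝ) 0
  have he1 : ∀ z, e z = (z 0, Fin.tail z) := fun z => rfl
  let S : Set (ℝ × (Fin m → ℝ)) := {p | (0 ≤ p.1 ∧ ∀ i, 0 ≤ p.2 i) ∧ p.1 + ∑ i, p.2 i ≤ 1}
  have hpre : e ⁻¹' S = cornerSimplex (m + 1) := by
    ext z
    simp [S, he1, cornerSimplex, Fin.forall_fin_succ, Fin.sum_univ_succ, Fin.tail]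
  have hS : IsClosed S := by
    refine IsClosed.and (IsClosed.and ?_ ?_) ?_
    · exact isClosed_le continuous_const continuous_fst
    · simp only [Set.ofPred_forall]
      exact isClosed_iInter fun i => isClosed_le continuous_const (by fun_prop)
    · exact isClosed_le (by fun_prop) continuous_const
  have hSc : IsCompact S := by
    refine (isCompact_Icc (a := ((0 : ℝ), (0 : Fin m → ℝ))) (b := (1, 1))).of_isClosed_subset hS
      fun p hp => ⟨⟨hp.1.1, hp.1.2⟩, ⟨?_, fun i => ?_⟩⟩
    · have := Finset.sum_nonneg fun i (_ : i ∈ Finset.univ) => hp.1.2 i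
      have h2 := hp.2
      show p.1 ≤ 1
      linarith
    · have := Finset.single_le_sum (fun j _ => hp.1.2 j) (Finset.mem_univ i)
      have h1 := hp.1.1
      have h2 := hp.2
      show p.2 i ≤ 1
      linarith
  have hint : Integrable (S.indicator fun p => G' p.1 p.2) (volume.prod volume) := by
    rw [integrable_indicator_iff hS.measurableSet]
    exact hG'.continuousOn.integrableOn_compact hSc
  calc ∫ z in cornerSimplex (m + 1), G' (z 0) (Fin.tail z)
      = ∫ p in S, G' p.1 p.2 := by
        rw [← he.setIntegral_preimage_emb e.measurableEmbedding, hpre]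
        rfl
    _ = ∫ p, S.indicator (fun p => G' p.1 p.2) p ∂(volume.prod volume) := by
        rw [integral_indicator hS.measurableSet]; rfl
    _ = ∫ y, ∫ t, S.indicator (fun p => G' p.1 p.2) (t, y) := integral_prod_symm _ hint
    _ = ∫ y, (cornerSimplex m).indicator (fun y => G (1 - ∑ j, y j) y - G 0 y) y := by
        congr 1
        funext y
        by_cases hy : y ∈ cornerSimplex m
        · rw [Set.indicator_of_mem hy]
          have h1 : ∀ t, S.indicator (fun p => G' p.1 p.2) (t, y) =
              (Set.Icc 0 (1 - ∑ j, y j)).indicator (fun t => G' t y) t := by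
            intro t
            simp only [Set.indicator_apply, S, Set.mem_ofPred_eq, Set.mem_Icc]
            congr 1
            simp only [hy.1, implies_true, and_true, le_sub_iff_add_le]
          simp_rw [h1]
          rw [integral_indicator measurableSet_Icc, integral_Icc_eq_integral_Ioc,
            ← intervalIntegral.integral_of_le (sub_nonneg.mpr hy.2)]
          refine intervalIntegral.integral_eq_sub_of_hasDerivAt (fun t _ => hG t y) ?_
          exact Continuous.intervalIntegrable (hG'.comp (by fun_prop : Continuous fun t => (t, y))) _ _
        · rw [Set.indicator_of_notMem hy]
          have h1 : ∀ t, S.indicator (fun p => G' p.1 p.2) (t, y) = 0 := by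
            intro t
            refine Set.indicator_of_notMem (fun h => hy ⟨h.1.2, ?_⟩) _
            have := h.1.1
            have := h.2
            simp only at *
            linarith
          simp [h1]
    _ = _ := integral_indicator (isClosed_cornerSimplex m).measurableSet

/-! ### The divergence theorem on a simplex -/

theorem exists_orthonormalBasis_zero_eq {n : ℕ} {ν : Euc (n + 1)} (hν : ‖ν‖ = 1) :
    ∃ β : OrthonormalBasis (Fin (n + 1)) ℝ (Euc (n + 1)), β 0 = ν := by
  obtain ⟨β, hβ⟩ := Orthonormal.exists_orthonormalBasis_extension_of_card_eq (𝕜 := ℝ)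
    (E := Euc (n + 1)) (ι := Fin (n + 1)) (by simp) (v := fun _ => ν) (s := {0})
    ⟨fun _ => hν, fun i j hij => (hij (Subsingleton.elim i j)).elim⟩
  exact ⟨β, hβ 0 rfl⟩

theorem eq_sum_tail_of_inner_eq_zero {n : ℕ}
    (β : OrthonormalBasis (Fin (n + 1)) ℝ (Euc (n + 1))) {v : Euc (n + 1)}
    (hv : inner ℝ (β 0) v = 0) : v = ∑ i : Fin n, inner ℝ (β i.succ) v • β i.succ := by
  have h := β.sum_repr v
  simp only [OrthonormalBasis.repr_apply_apply, Fin.sum_univ_succ, hv, zero_smul, zero_add] at h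
  exact h.symm

/-- The factor `|ν·u|` turns the Jacobian of the facet into a determinant of full size, comparable
with the Jacobian of a cell having `u` as an edge. -/
theorem setIntegral_facet {n : ℕ} {ν : Euc (n + 1)} (hν : ‖ν‖ = 1)
    {q : Fin (n + 1) → Euc (n + 1)} (hq : AffineIndependent ℝ q)
    (hνq : ∀ j : Fin n, inner ℝ ν (q j.succ - q 0) = 0)
    (γ : OrthonormalBasis (Fin (n + 1)) ℝ (Euc (n + 1))) (u : Euc (n + 1))
    (f : Euc (n + 1) → ℝ) :
    |inner ℝ ν u| * ∫ x in convexHull ℝ (Set.range q), f x ∂μHE[n] =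
      |(Matrix.of fun i j : Fin (n + 1) => inner ℝ (γ i)
        ((Fin.cons u fun j => q j.succ - q 0 : Fin (n + 1) → Euc (n + 1)) j)).det| *
        ∫ y in cornerSimplex n, f (simplexParam q y) := by
  obtain ⟨β, rfl⟩ := exists_orthonormalBasis_zero_eq hν
  rw [setIntegral_simplex (b := fun i : Fin n => β i.succ)
    (β.orthonormal.comp _ (Fin.succ_injective n)) hq
    (fun j => eq_sum_tail_of_inner_eq_zero β (hνq j)), ← mul_assoc,
    abs_det_inner_orthonormalBasis γ β, ← abs_mul]
  congr 2
  -- In a basis starting with `ν` the first row is `(ν·u, 0, …, 0)`.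
  rw [Matrix.det_succ_row_zero, Fin.sum_univ_succ]
  simp only [Matrix.of_apply, Fin.cons_zero, Fin.cons_succ, hνq, mul_zero, zero_mul,
    Finset.sum_const_zero, add_zero, Fin.val_zero, pow_zero, one_mul]
  congr 2

theorem euclideanHausdorffMeasure_facet_lt_top {n : ℕ} {ν : Euc (n + 1)} (hν : ‖ν‖ = 1)
    {q : Fin (n + 1) → Euc (n + 1)} (hq : AffineIndependent ℝ q)
    (hνq : ∀ j : Fin n, inner ℝ ν (q j.succ - q 0) = 0) :
    (μHE[n] : Measure (Euc (n + 1))) (convexHull ℝ (Set.range q)) < ⊤ := by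
  obtain ⟨β, rfl⟩ := exists_orthonormalBasis_zero_eq hν
  exact euclideanHausdorffMeasure_simplex_lt_top (b := fun i : Fin n => β i.succ)
    (β.orthonormal.comp _ (Fin.succ_injective n)) hq
    (fun j => eq_sum_tail_of_inner_eq_zero β (hνq j))

theorem setIntegral_cell {d : ℕ} {q : Fin (d + 1) → Euc d} (hq : AffineIndependent ℝ q)
    (γ : OrthonormalBasis (Fin d) ℝ (Euc d)) (f : Euc d → ℝ) :
    ∫ x in convexHull ℝ (Set.range q), f x =
      |(Matrix.of fun i j : Fin d => inner ℝ (γ i) (q j.succ - q 0)).det| *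
        ∫ y in cornerSimplex d, f (simplexParam q y) := by
  rw [← EuclideanSpace.euclideanHausdorffMeasure_eq_volume]
  refine setIntegral_simplex γ.orthonormal hq (fun j => ?_) f
  have h := γ.sum_repr (q j.succ - q 0)
  simp only [OrthonormalBasis.repr_apply_apply] at h
  exact h.symm

/-- Moving the base point of a simplex from `b` to `a` adds the first column to the others and flips
its sign. -/
theorem abs_det_cons_sub {n : ℕ} (γ : OrthonormalBasis (Fin (n + 1)) ℝ (Euc (n + 1)))
    (a b : Euc (n + 1)) (w : Fin n → Euc (n + 1)) :
    |(Matrix.of fun i j : Fin (n + 1) => inner ℝ (γ i)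
        ((Fin.cons (a - b) fun j => w j - b : Fin (n + 1) → Euc (n + 1)) j)).det| =
    |(Matrix.of fun i j : Fin (n + 1) => inner ℝ (γ i)
        ((Fin.cons (b - a) fun j => w j - a : Fin (n + 1) → Euc (n + 1)) j)).det| := by
  have h1 : (Matrix.of fun i j : Fin (n + 1) => inner ℝ (γ i)
        ((Fin.cons (a - b) fun j => w j - b : Fin (n + 1) → Euc (n + 1)) j)).det =
      (Matrix.of fun i j : Fin (n + 1) => inner ℝ (γ i)
        ((Fin.cons (a - b) fun j => w j - a : Fin (n + 1) → Euc (n + 1)) j)).det := by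
    rw [← Matrix.det_transpose, ← Matrix.det_transpose (Matrix.of _)]
    refine Matrix.det_eq_of_forall_row_eq_smul_add_const (Fin.cons 0 fun _ => 1) 0 rfl
      fun i j => ?_
    refine Fin.cases ?_ (fun i => ?_) i
    · simp
    · simp only [Matrix.transpose_apply, Matrix.of_apply, Fin.cons_succ, Fin.cons_zero, one_mul,
        ← inner_add_right]
      congr 1
      abel
  have h2 : (Matrix.of fun i j : Fin (n + 1) => inner ℝ (γ i)
        ((Fin.cons (a - b) fun j => w j - a : Fin (n + 1) → Euc (n + 1)) j)) =
      Matrix.of fun i j => (Fin.cons (-1) fun _ => 1 : Fin (n + 1) → ℝ) j *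
        (Matrix.of fun i j : Fin (n + 1) => inner ℝ (γ i)
        ((Fin.cons (b - a) fun j => w j - a : Fin (n + 1) → Euc (n + 1)) j)) i j := by
    ext i j
    refine Fin.cases ?_ (fun j => ?_) j
    · simp only [Matrix.of_apply, Fin.cons_zero, neg_mul, one_mul, ← inner_neg_right, neg_sub]
    · simp
  rw [h1, h2, Matrix.det_mul_row]
  simp [Fin.prod_univ_succ]

/-- With `a` as origin and `b - a` as first edge, the derivative along `b - a` is the derivative in
the first coordinate. Integrating it leaves the facet opposite `a` minus the facet opposite `b`. The
Jacobians agree up to the factors `νa·(b - a) > 0` and `νb·(b - a) < 0`, whose signs match that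
difference. -/
theorem integral_fderiv_edge {n : ℕ} {a b : Euc (n + 1)} {w : Fin n → Euc (n + 1)}
    (hq : AffineIndependent ℝ (Fin.cons a (Fin.cons b w : Fin (n + 1) → Euc (n + 1)) :
      Fin (n + 2) → Euc (n + 1)))
    {νa νb : Euc (n + 1)} (hνa : ‖νa‖ = 1) (hνb : ‖νb‖ = 1)
    (ha : ∀ j, inner ℝ νa (w j - b) = 0) (hb : ∀ j, inner ℝ νb (w j - a) = 0)
    (ha' : inner ℝ νa (a - b) < 0) (hb' : inner ℝ νb (b - a) < 0)
    {f : Euc (n + 1) → ℝ} (hf : ContDiff ℝ 1 f) :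
    ∫ x in convexHull ℝ (Set.range (Fin.cons a (Fin.cons b w : Fin (n + 1) → Euc (n + 1)) :
      Fin (n + 2) → Euc (n + 1))), fderiv ℝ f x (b - a) =
      inner ℝ νa (b - a) * ∫ x in convexHull ℝ (Set.range (Fin.cons b w :
        Fin (n + 1) → Euc (n + 1))), f x ∂μHE[n] +
      inner ℝ νb (b - a) * ∫ x in convexHull ℝ (Set.range (Fin.cons a w :
        Fin (n + 1) → Euc (n + 1))), f x ∂μHE[n] := by
  have hqb : AffineIndependent ℝ (Fin.cons b w : Fin (n + 1) → Euc (n + 1)) := by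
    have h := hq.comp_embedding (Fin.succEmb (n + 1))
    have h2 : (Fin.cons a (Fin.cons b w : Fin (n + 1) → Euc (n + 1)) :
      Fin (n + 2) → Euc (n + 1)) ∘ Fin.succEmb (n + 1) = Fin.cons b w := by
      funext j; simp
    rwa [h2] at h
  have hqa : AffineIndependent ℝ (Fin.cons a w : Fin (n + 1) → Euc (n + 1)) := by
    have h := hq.comp_embedding (Fin.succAboveEmb (1 : Fin (n + 2)))
    have h2 : (Fin.cons a (Fin.cons b w : Fin (n + 1) → Euc (n + 1)) :
      Fin (n + 2) → Euc (n + 1)) ∘ Fin.succAboveEmb (1 : Fin (n + 2)) = Fin.cons a w := by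
      funext j
      refine Fin.cases ?_ (fun j => ?_) j
      · simp
      · have h3 : (1 : Fin (n + 2)).succAbove j.succ = j.succ.succ :=
          Fin.succAbove_of_le_castSucc _ _ (by simp [Fin.le_def])
        simp [h3]
    rwa [h2] at h
  let γ := EuclideanSpace.basisFun (Fin (n + 1)) ℝ
  have Ha := setIntegral_facet hνa hqb (by simpa using ha) γ (a - b) f
  have Hb := setIntegral_facet hνb hqa (by simpa using hb) γ (b - a) f
  have HK := setIntegral_cell hq γ fun x => fderiv ℝ f x (b - a)
  simp only [Fin.cons_zero, Fin.cons_succ] at Ha Hb HK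
  rw [abs_det_cons_sub, abs_of_neg ha', ← inner_neg_right, neg_sub] at Ha
  rw [abs_of_neg hb'] at Hb
  have hcons : (fun j : Fin (n + 1) => (Fin.cons b w : Fin (n + 1) → Euc (n + 1)) j - a) =
      Fin.cons (b - a) fun j => w j - a := by
    funext j
    refine Fin.cases ?_ (fun j => ?_) j <;> simp
  have hmat : (Matrix.of fun i j : Fin (n + 1) =>
      inner ℝ (γ i) ((Fin.cons b w : Fin (n + 1) → Euc (n + 1)) j - a)) =
      Matrix.of fun i j => inner ℝ (γ i)
        ((Fin.cons (b - a) fun j => w j - a : Fin (n + 1) → Euc (n + 1)) j) := by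
    ext i j
    simp only [Matrix.of_apply, ← hcons]
  rw [hmat] at HK
  let P : ℝ → (Fin n → ℝ) → Euc (n + 1) := fun t y => a + (t • (b - a) + ∑ j, y j • (w j - a))
  have hFTC := integral_cornerSimplex_succ (m := n) (G := fun t y => f (P t y))
    (G' := fun t y => fderiv ℝ f (P t y) (b - a))
    (((hf.continuous_fderiv one_ne_zero).comp (by fun_prop)).clm_apply continuous_const)
    (fun t y => by
      have h1 : HasDerivAt (fun t => P t y) (b - a) t := by
        have h := (((hasDerivAt_id t).smul_const (b - a)).add_const
          (∑ j, y j • (w j - a))).const_add a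
        simpa only [id, one_smul] using h
      exact ((hf.differentiable one_ne_zero) (P t y)).hasFDerivAt.comp_hasDerivAt t h1)
  have hI : ∀ z : Fin (n + 1) → ℝ, simplexParam (Fin.cons a (Fin.cons b w :
      Fin (n + 1) → Euc (n + 1)) : Fin (n + 2) → Euc (n + 1)) z = P (z 0) (Fin.tail z) := by
    intro z
    simp [simplexParam, P, Fin.sum_univ_succ, Fin.tail]
  have hPb : ∀ y, P (1 - ∑ j, y j) y = simplexParam (Fin.cons b w :
      Fin (n + 1) → Euc (n + 1)) y := by
    intro y
    simp only [simplexParam, P, Fin.cons_zero, Fin.cons_succ, smul_sub, Finset.sum_sub_distrib,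
      ← Finset.sum_smul]
    module
  have hPa : ∀ y, P 0 y = simplexParam (Fin.cons a w : Fin (n + 1) → Euc (n + 1)) y := by
    intro y
    simp [simplexParam, P]
  simp_rw [hI] at HK
  rw [hFTC, integral_sub] at HK
  · simp_rw [hPb, hPa] at HK
    linarith
  · exact ((hf.continuous.comp (by fun_prop)).continuousOn).integrableOn_compact
      (isCompact_cornerSimplex n)
  · exact ((hf.continuous.comp (by fun_prop)).continuousOn).integrableOn_compact
      (isCompact_cornerSimplex n)

/-- `ν a` is the outward unit normal to the facet of the simplex `K` opposite to the vertex `a`. -/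
structure IsOutwardNormal {d : ℕ} (K : Finset (Euc d)) (ν : Euc d → Euc d) : Prop where
  norm_eq_one : ∀ a ∈ K, ‖ν a‖ = 1
  orthogonal : ∀ a ∈ K, ∀ x ∈ K.erase a, ∀ y ∈ K.erase a, inner ℝ (ν a) (y - x) = 0
  outward : ∀ a ∈ K, ∀ x ∈ K.erase a, inner ℝ (ν a) (a - x) < 0

theorem exists_fin_range_eq {E : Type*} {s : Finset E} {n : ℕ} (hs : s.card = n) :
    ∃ w : Fin n → E, Function.Injective w ∧ Set.range w = (s : Set E) := by
  refine ⟨fun i => ((s.equivFinOfCardEq hs).symm i : E),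
    Subtype.val_injective.comp (Equiv.injective _), ?_⟩
  ext x
  constructor
  · rintro ⟨i, rfl⟩
    exact Finset.coe_mem _
  · intro hx
    exact ⟨s.equivFinOfCardEq hs ⟨x, hx⟩, by simp⟩

theorem affineIndependent_of_range_subset {ι E : Type*} [AddCommGroup E] [Module ℝ E]
    {K : Finset E} (hK : AffineIndependent ℝ ((↑) : K → E)) {q : ι → E}
    (hq : Function.Injective q) (hr : Set.range q ⊆ (K : Set E)) : AffineIndependent ℝ q :=
  hK.comp_embedding
    ⟨fun i => (⟨q i, hr ⟨i, rfl⟩⟩ : K), fun _ _ hij => hq (congrArg Subtype.val hij)⟩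

theorem euclideanHausdorffMeasure_convexHull_lt_top {n : ℕ} {F : Finset (Euc (n + 1))}
    (hF : AffineIndependent ℝ ((↑) : F → Euc (n + 1))) (hcard : F.card = n + 1)
    {ν : Euc (n + 1)} (hν : ‖ν‖ = 1) (hν' : ∀ x ∈ F, ∀ y ∈ F, inner ℝ ν (y - x) = 0) :
    (μHE[n] : Measure (Euc (n + 1))) (convexHull ℝ (F : Set (Euc (n + 1)))) < ⊤ := by
  obtain ⟨q, hq, hr⟩ := exists_fin_range_eq hcard
  have hm : ∀ i, q i ∈ F := fun i => by
    rw [← Finset.mem_coe, ← hr]; exact ⟨i, rfl⟩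
  rw [← hr]
  exact euclideanHausdorffMeasure_facet_lt_top hν
    (affineIndependent_of_range_subset hF hq hr.le) fun j => hν' _ (hm _) _ (hm _)

-- Only the facets opposite `a` and `b` contribute: any other facet contains both points, so its
-- normal is orthogonal to `b - a`.
open Classical in
theorem integral_fderiv_sub {n : ℕ} {K : Finset (Euc (n + 1))}
    (hK : AffineIndependent ℝ ((↑) : K → Euc (n + 1))) (hcard : K.card = n + 2)
    {ν : Euc (n + 1) → Euc (n + 1)} (hν : IsOutwardNormal K ν) {f : Euc (n + 1) → ℝ}
    (hf : ContDiff ℝ 1 f) {a b : Euc (n + 1)} (ha : a ∈ K) (hb : b ∈ K) (hab : a ≠ b) :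
    ∫ x in convexHull ℝ (K : Set (Euc (n + 1))), fderiv ℝ f x (b - a) =
      ∑ c ∈ K, inner ℝ (ν c) (b - a) *
        ∫ x in convexHull ℝ (K.erase c : Set (Euc (n + 1))), f x ∂μHE[n] := by
  have hbe : b ∈ K.erase a := Finset.mem_erase.mpr ⟨hab.symm, hb⟩
  have hae : a ∈ K.erase b := Finset.mem_erase.mpr ⟨hab, ha⟩
  have hrest : ((K.erase a).erase b).card = n := by
    rw [Finset.card_erase_of_mem hbe, Finset.card_erase_of_mem ha, hcard]; rfl
  obtain ⟨w, hw, hwr⟩ := exists_fin_range_eq hrest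
  have hwm : ∀ j, w j ∈ (K.erase a).erase b := fun j => by
    rw [← Finset.mem_coe, ← hwr]; exact ⟨j, rfl⟩
  have hwb : ∀ j, w j ∈ K.erase a := fun j => Finset.mem_of_mem_erase (hwm j)
  have hwa : ∀ j, w j ∈ K.erase b := fun j => by
    have := hwm j
    rw [Finset.erase_right_comm] at this
    exact Finset.mem_of_mem_erase this
  have hrb : Set.range (Fin.cons b w : Fin (n + 1) → Euc (n + 1)) = (K.erase a : Set _) := by
    rw [Fin.range_cons, hwr, ← Finset.coe_insert, Finset.insert_erase hbe]
  have hra : Set.range (Fin.cons a w : Fin (n + 1) → Euc (n + 1)) = (K.erase b : Set _) := by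
    rw [Fin.range_cons, hwr, Finset.erase_right_comm, ← Finset.coe_insert,
      Finset.insert_erase hae]
  have hr : Set.range (Fin.cons a (Fin.cons b w : Fin (n + 1) → Euc (n + 1)) :
      Fin (n + 2) → Euc (n + 1)) = (K : Set _) := by
    rw [Fin.range_cons, hrb, ← Finset.coe_insert, Finset.insert_erase ha]
  have hqi : Function.Injective (Fin.cons a (Fin.cons b w : Fin (n + 1) → Euc (n + 1)) :
      Fin (n + 2) → Euc (n + 1)) := by
    refine Fin.cons_injective_iff.mpr ⟨?_, Fin.cons_injective_iff.mpr ⟨?_, hw⟩⟩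
    · rw [hrb]; simp
    · rw [hwr]; simp
  have h := integral_fderiv_edge (affineIndependent_of_range_subset hK hqi hr.le)
    (hν.norm_eq_one a ha) (hν.norm_eq_one b hb)
    (fun j => hν.orthogonal a ha _ hbe _ (hwb j)) (fun j => hν.orthogonal b hb _ hae _ (hwa j))
    (hν.outward a ha b hbe) (hν.outward b hb a hae) hf
  rw [hr, hra, hrb] at h
  rw [h, ← Finset.add_sum_erase _ _ ha, ← Finset.add_sum_erase _ _ hbe]
  rw [Finset.sum_eq_zero (s := (K.erase a).erase b), add_zero]
  intro c hc
  have hcb := Finset.ne_of_mem_erase hc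
  have hca := Finset.ne_of_mem_erase (Finset.mem_of_mem_erase hc)
  have hcK := Finset.mem_of_mem_erase (Finset.mem_of_mem_erase hc)
  rw [hν.orthogonal c hcK a (Finset.mem_erase.mpr ⟨hca.symm, ha⟩) b
    (Finset.mem_erase.mpr ⟨hcb.symm, hb⟩), zero_mul]

theorem isCompact_convexHull_finset {d : ℕ} (K : Finset (Euc d)) :
    IsCompact (convexHull ℝ (K : Set (Euc d))) :=
  K.finite_toSet.isCompact_convexHull (𝕜 := ℝ)

-- Both sides are linear in `e`, and the edges of a nondegenerate simplex span the space.
open Classical in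
theorem integral_fderiv_simplex {n : ℕ} {K : Finset (Euc (n + 1))}
    (hK : AffineIndependent ℝ ((↑) : K → Euc (n + 1))) (hcard : K.card = n + 2)
    {ν : Euc (n + 1) → Euc (n + 1)} (hν : IsOutwardNormal K ν) {f : Euc (n + 1) → ℝ}
    (hf : ContDiff ℝ 1 f) (e : Euc (n + 1)) :
    ∫ x in convexHull ℝ (K : Set (Euc (n + 1))), fderiv ℝ f x e =
      ∑ c ∈ K, inner ℝ (ν c) e *
        ∫ x in convexHull ℝ (K.erase c : Set (Euc (n + 1))), f x ∂μHE[n] := by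
  have hspan : vectorSpan ℝ (Set.range ((↑) : K → Euc (n + 1))) = ⊤ :=
    hK.vectorSpan_eq_top_of_card_eq_finrank_add_one (by simp [hcard])
  have he : e ∈ Submodule.span ℝ (Set.range ((↑) : K → Euc (n + 1)) -ᵥ
      Set.range ((↑) : K → Euc (n + 1))) := by
    have : e ∈ vectorSpan ℝ (Set.range ((↑) : K → Euc (n + 1))) := hspan ▸ Submodule.mem_top
    exact this
  have hint : ∀ e, IntegrableOn (fun x => fderiv ℝ f x e)
      (convexHull ℝ (K : Set (Euc (n + 1)))) := fun e =>
    ((hf.continuous_fderiv one_ne_zero).clm_apply continuous_const).continuousOn.integrableOn_compact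
      (isCompact_convexHull_finset K)
  induction he using Submodule.span_induction with
  | mem x hx =>
    obtain ⟨_, ⟨b, rfl⟩, _, ⟨a, rfl⟩, rfl⟩ := hx
    simp only [vsub_eq_sub]
    by_cases hab : (a : Euc (n + 1)) = b
    · simp [hab]
    · exact integral_fderiv_sub hK hcard hν hf a.2 b.2 hab
  | zero => simp
  | add x y _ _ hx hy =>
    simp only [map_add, inner_add_right, add_mul, Finset.sum_add_distrib]
    rw [integral_add (hint x) (hint y), hx, hy]
  | smul t x _ hx =>
    simp only [map_smul, smul_eq_mul, inner_smul_right, mul_assoc, ← Finset.mul_sum]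
    rw [integral_const_mul, hx]

theorem integrableOn_convexHull_facet {n : ℕ} {F : Finset (Euc (n + 1))}
    (hF : AffineIndependent ℝ ((↑) : F → Euc (n + 1))) (hcard : F.card = n + 1)
    {ν : Euc (n + 1)} (hν : ‖ν‖ = 1) (hν' : ∀ x ∈ F, ∀ y ∈ F, inner ℝ ν (y - x) = 0)
    {f : Euc (n + 1) → ℝ} (hf : Continuous f) :
    IntegrableOn f (convexHull ℝ (F : Set (Euc (n + 1)))) μHE[n] := by
  have hc := isCompact_convexHull_finset F
  obtain ⟨C, hC⟩ := hc.exists_bound_of_continuousOn hf.continuousOn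
  exact IntegrableOn.of_bound (euclideanHausdorffMeasure_convexHull_lt_top hF hcard hν hν')
    hf.aestronglyMeasurable C
    ((ae_restrict_iff' hc.measurableSet).mpr (Filter.Eventually.of_forall hC))

open Classical in
/-- The divergence theorem on a simplex. -/
theorem integral_divergence_simplex {n : ℕ} {K : Finset (Euc (n + 1))}
    (hK : AffineIndependent ℝ ((↑) : K → Euc (n + 1))) (hcard : K.card = n + 2)
    {ν : Euc (n + 1) → Euc (n + 1)} (hν : IsOutwardNormal K ν) {g : Euc (n + 1) → Euc (n + 1)}
    (hg : ContDiff ℝ 1 g) :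
    ∫ x in convexHull ℝ (K : Set (Euc (n + 1))), divergence g x =
      ∑ c ∈ K, ∫ x in convexHull ℝ (K.erase c : Set (Euc (n + 1))),
        inner ℝ (g x) (ν c) ∂μHE[n] := by
  have hgi : ∀ i, ContDiff ℝ 1 fun x => g x i := fun i => contDiff_euclidean.mp hg i
  have hd : ∀ x i (e : Euc (n + 1)), fderiv ℝ g x e i = fderiv ℝ (fun x => g x i) x e := by
    intro x i e
    have h := (EuclideanSpace.proj (𝕜 := ℝ) i).hasFDerivAt.comp x
      ((hg.differentiable one_ne_zero) x).hasFDerivAt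
    exact (congrArg (fun l => l e) h.fderiv).symm
  have h1 : ∀ c ∈ K, ∫ x in convexHull ℝ (K.erase c : Set (Euc (n + 1))),
        inner ℝ (g x) (ν c) ∂μHE[n] = ∑ i, inner ℝ (ν c) (EuclideanSpace.single i 1) *
        ∫ x in convexHull ℝ (K.erase c : Set (Euc (n + 1))), g x i ∂μHE[n] := by
    intro c hc
    simp_rw [← integral_const_mul]
    rw [← integral_finsetSum]
    · congr 1
      funext x
      simp [PiLp.inner_apply]
    · intro i _
      refine Integrable.const_mul ?_ _
      refine integrableOn_convexHull_facet (affineIndependent_of_range_subset hK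
        (q := ((↑) : K.erase c → Euc (n + 1))) Subtype.val_injective
        (by rw [Subtype.range_coe]; exact Finset.coe_subset.mpr (Finset.erase_subset c K))) ?_
        (hν.norm_eq_one c hc) (hν.orthogonal c hc) (hgi i).continuous
      rw [Finset.card_erase_of_mem hc, hcard]; rfl
  rw [Finset.sum_congr rfl h1, Finset.sum_comm]
  simp only [divergence, hd]
  rw [integral_finsetSum]
  · exact Finset.sum_congr rfl fun i _ => integral_fderiv_simplex hK hcard hν (hgi i) _
  · intro i _
    exact (((hgi i).continuous_fderiv one_ne_zero).clm_apply
      continuous_const).continuousOn.integrableOn_compact (isCompact_convexHull_finset K)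

/-! ### Cells and faces of a mesh -/

section Combinatorics

variable {d : ℕ} {Ω : Set (Euc d)} {T : Mesh Ω}

theorem Mesh.mem_cells {K : Finset (Euc d)} : K ∈ T.cells ↔ K ∈ T.faces ∧ K.card = d + 1 := by
  simp [Mesh.cells]

theorem Mesh.mem_skel {F : Finset (Euc d)} : F ∈ T.skel ↔ F ∈ T.faces ∧ F.card = d := by
  simp [Mesh.skel]

theorem Mesh.mem_intFaces {F : Finset (Euc d)} : F ∈ T.intFaces ↔
    F ∈ T.skel ∧ ∃ K ∈ T.cells, ∃ L ∈ T.cells, K ≠ L ∧ F ⊆ K ∧ F ⊆ L := by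
  simp [Mesh.intFaces]

theorem Mesh.mem_bdryFaces {F : Finset (Euc d)} : F ∈ T.bdryFaces ↔
    F ∈ T.skel ∧ ∃! K, K ∈ T.cells ∧ F ⊆ K := by
  simp [Mesh.bdryFaces]

/-- Purity puts every face in at least one cell, so "exactly one" is the negation of "two distinct".
-/
theorem Mesh.mem_bdryFaces_iff {F : Finset (Euc d)} :
    F ∈ T.bdryFaces ↔ F ∈ T.skel ∧ F ∉ T.intFaces := by
  rw [Mesh.mem_bdryFaces, Mesh.mem_intFaces]
  refine and_congr_right fun hF => ?_
  constructor
  · rintro ⟨K, -, hK⟩ ⟨-, L, hL, L', hL', hne, hFL, hFL'⟩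
    exact hne ((hK L ⟨hL, hFL⟩).trans (hK L' ⟨hL', hFL'⟩).symm)
  · intro h
    obtain ⟨K, hK, hFK, hcard⟩ := T.pure_dim F (Mesh.mem_skel.mp hF).1
    have hKc : K ∈ T.cells := Mesh.mem_cells.mpr ⟨hK, hcard⟩
    refine ⟨K, ⟨hKc, hFK⟩, fun L hL => ?_⟩
    by_contra hne
    exact h ⟨hF, L, hL.1, K, hKc, hne, hL.2, hFK⟩

open Classical in
theorem Mesh.skel_eq_union : T.skel = T.intFaces ∪ T.bdryFaces := by
  ext F
  rw [Finset.mem_union, Mesh.mem_bdryFaces_iff, Mesh.mem_intFaces]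
  tauto

theorem Mesh.disjoint_intFaces_bdryFaces : Disjoint T.intFaces T.bdryFaces :=
  Finset.disjoint_left.mpr fun _ h h' => (Mesh.mem_bdryFaces_iff.mp h').2 h

theorem Mesh.affineIndependent_cell {K : Finset (Euc d)} (hK : K ∈ T.cells) :
    AffineIndependent ℝ ((↑) : K → Euc d) := T.indep (Mesh.mem_cells.mp hK).1

theorem Mesh.mem_skel_of_subset (hd : 0 < d) {K F : Finset (Euc d)} (hK : K ∈ T.cells)
    (hFK : F ⊆ K) (hF : F.card = d) : F ∈ T.skel :=
  Mesh.mem_skel.mpr ⟨(T.isRelLowerSet_faces (Mesh.mem_cells.mp hK).1).2 hFK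
    (Finset.card_pos.mp (by omega)), hF⟩

open Classical in
theorem Mesh.erase_mem_skel (hd : 0 < d) {K : Finset (Euc d)} (hK : K ∈ T.cells) {a : Euc d}
    (ha : a ∈ K) : K.erase a ∈ T.skel :=
  Mesh.mem_skel_of_subset hd hK (K.erase_subset a)
    (by rw [Finset.card_erase_of_mem ha, (Mesh.mem_cells.mp hK).2]; rfl)

open Classical in
theorem Mesh.exists_eq_insert {K F : Finset (Euc d)} (hK : K ∈ T.cells) (hF : F ∈ T.skel)
    (hFK : F ⊆ K) : ∃ a ∉ F, insert a F = K := by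
  have h := (Finset.exists_eq_insert_iff (s := F) (t := K)).mpr
    ⟨hFK, by rw [(Mesh.mem_cells.mp hK).2, (Mesh.mem_skel.mp hF).2]⟩
  exact h

theorem Mesh.span_cell {K : Finset (Euc d)} (hK : K ∈ T.cells) :
    vectorSpan ℝ (Set.range ((↑) : K → Euc d)) = ⊤ :=
  (Mesh.affineIndependent_cell hK).vectorSpan_eq_top_of_card_eq_finrank_add_one
    (by simp [(Mesh.mem_cells.mp hK).2])

open Classical in
/-- The vertex opposite to a face of a cell does not lie in the hyperplane of the face. -/
theorem Mesh.inner_ne_zero {F : Finset (Euc d)} {b : Euc d} (hK : insert b F ∈ T.cells)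
    {ν x : Euc d} (hν : ν ≠ 0) (hνF : ∀ y ∈ F, inner ℝ ν (y - x) = 0) :
    inner ℝ ν (b - x) ≠ 0 := by
  intro h
  apply hν
  have hall : ∀ y ∈ insert b F, inner ℝ ν (y - x) = 0 := by
    intro y hy
    rcases Finset.mem_insert.mp hy with rfl | hy
    · exact h
    · exact hνF y hy
  -- Otherwise `ν` is orthogonal to all edges of the cell. These span, so `ν` is orthogonal to
  -- itself.
  have hle : vectorSpan ℝ (Set.range ((↑) : ↥(insert b F : Finset (Euc d)) → Euc d)) ≤
      (innerSL ℝ ν : Euc d →L[ℝ] ℝ).ker := by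
    refine Submodule.span_le.mpr ?_
    rintro _ ⟨_, ⟨y, rfl⟩, _, ⟨z, rfl⟩, rfl⟩
    have : (y : Euc d) - z = (y - x) - (z - x) := by abel
    change inner ℝ ν ((y : Euc d) - z) = 0
    rw [this, inner_sub_right, hall y y.2, hall z z.2, sub_zero]
  rw [Mesh.span_cell hK] at hle
  have := hle (Submodule.mem_top (x := ν))
  simpa using this

open Classical in
/-- Two cells sharing a face and lying on the same side of it coincide. -/
theorem Mesh.opposite_eq_of_same_side {F : Finset (Euc d)} {a b : Euc d} (haF : a ∉ F)
    (hbF : b ∉ F) (hK : insert a F ∈ T.cells) (hL : insert b F ∈ T.cells) {ν x : Euc d}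
    (hx : x ∈ F) (hνF : ∀ y ∈ F, inner ℝ ν (y - x) = 0) (ha : inner ℝ ν (a - x) < 0)
    (hb : inner ℝ ν (b - x) < 0) : a = b := by
  by_contra hab
  have hFK : F ⊆ insert a F := Finset.subset_insert _ _
  have hFL : F ⊆ insert b F := Finset.subset_insert _ _
  -- If the apexes differ, the common vertices are those of `F`, and conformity confines the
  -- intersection to `F`. The contradiction is a common point off the hyperplane of `F`: move
  -- slightly from the barycentre `c` of `F` towards `a`.
  have hinter : convexHull ℝ ((insert a F : Finset (Euc d)) : Set (Euc d)) ∩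
      convexHull ℝ ((insert b F : Finset (Euc d)) : Set (Euc d)) ⊆ convexHull ℝ (F : Set _) := by
    refine (T.inter_subset_convexHull (Mesh.mem_cells.mp hK).1 (Mesh.mem_cells.mp hL).1).trans
      (convexHull_mono ?_)
    rintro y ⟨hy, hy'⟩
    rcases Finset.mem_insert.mp hy with rfl | h
    · rcases Finset.mem_insert.mp hy' with rfl | h
      · exact (hab rfl).elim
      · exact h
    · exact h
  have hplane : ∀ z ∈ convexHull ℝ (F : Set (Euc d)), inner ℝ ν (z - x) = 0 := by
    intro z hz
    have hconv : Convex ℝ {z : Euc d | inner ℝ ν z = inner ℝ ν x} :=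
      convex_hyperplane (f := fun z => inner ℝ ν z)
        ⟨fun _ _ => inner_add_right _ _ _, fun _ _ => inner_smul_right _ _ _⟩ _
    have := convexHull_min (s := (F : Set (Euc d))) (fun y hy => by
      have := hνF y hy
      rw [inner_sub_right, sub_eq_zero] at this
      exact this) hconv hz
    rw [inner_sub_right, sub_eq_zero]
    exact this
  let L := insert b F
  let B : AffineBasis L ℝ (Euc d) :=
    ⟨(↑), Mesh.affineIndependent_cell hL, by
      rw [(Mesh.affineIndependent_cell hL).affineSpan_eq_top_iff_card_eq_finrank_add_one]
      simp [(Mesh.mem_cells.mp hL).2]⟩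
  let ib : L := ⟨b, Finset.mem_insert_self _ _⟩
  have hcoordF : ∀ i : L, ∀ y (hy : y ∈ F), B.coord i y = if i = ⟨y, hFL hy⟩ then 1 else 0 :=
    fun i y hy => B.coord_apply i ⟨y, hFL hy⟩
  let w : Euc d → ℝ := fun _ => (F.card : ℝ)⁻¹
  have hcard : 0 < (F.card : ℝ) := by exact_mod_cast Finset.card_pos.mpr ⟨x, hx⟩
  have hw : ∑ y ∈ F, w y = 1 := by simp [w, hcard.ne']
  let c := F.affineCombination ℝ id w
  have hcF : c ∈ convexHull ℝ (F : Set (Euc d)) := by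
    simp only [c, F.affineCombination_eq_linear_combination _ _ hw]
    exact (convex_convexHull ℝ _).sum_mem (fun _ _ => (inv_pos.mpr hcard).le) hw
      fun y hy => subset_convexHull ℝ _ hy
  have hcoordc : ∀ i : L, B.coord i c = ∑ y ∈ F, w y * B.coord i y := by
    intro i
    simp only [c]
    rw [Finset.map_affineCombination _ _ _ hw,
      Finset.affineCombination_eq_linear_combination _ _ _ hw]
    simp
  have hcb : B.coord ib c = 0 := by
    rw [hcoordc]
    refine Finset.sum_eq_zero fun y hy => ?_
    rw [hcoordF ib y hy, if_neg, mul_zero]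
    intro h
    have hby : b = y := congrArg Subtype.val h
    exact hbF (hby ▸ hy)
  have hcpos : ∀ i : L, i ≠ ib → 0 < B.coord i c := by
    intro i hi
    have hiF : (i : Euc d) ∈ F :=
      (Finset.mem_insert.mp i.2).resolve_left fun h => hi (Subtype.ext h)
    rw [hcoordc, Finset.sum_eq_single (i : Euc d)]
    · rw [hcoordF i i hiF, if_pos rfl, mul_one]
      exact inv_pos.mpr hcard
    · intro y hy hne
      rw [hcoordF i y hy, if_neg, mul_zero]
      intro h
      exact hne (congrArg Subtype.val h).symm
    · exact fun h => (h hiF).elim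
  -- Applying `ν` to the barycentric expansion of `a - x` kills all vertices of `F`, so the
  -- coordinate of `a` at `b` is a ratio of two negative numbers.
  have hab' : B.coord ib a * inner ℝ ν (b - x) = inner ℝ ν (a - x) := by
    have h1 : a - x = ∑ i, B.coord i a • ((i : Euc d) - x) := by
      simp only [smul_sub, Finset.sum_sub_distrib, ← Finset.sum_smul, B.sum_coord_apply_eq_one,
        one_smul]
      congr 1
      exact (B.linear_combination_coord_eq_self a).symm
    rw [h1, inner_sum, Finset.sum_eq_single ib]
    · rw [inner_smul_right]
    · intro i _ hi
      have hiF : (i : Euc d) ∈ F :=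
        (Finset.mem_insert.mp i.2).resolve_left fun h => hi (Subtype.ext h)
      rw [inner_smul_right, hνF i hiF, mul_zero]
    · simp
  have hapos : 0 < B.coord ib a := by
    by_contra hneg
    nlinarith [mul_nonneg_of_nonpos_of_nonpos (not_lt.mp hneg) hb.le]
  -- From `c` towards `a`, the coordinate at `b` starts at `0` and increases; the others start
  -- positive and stay so for small `ε`.
  have hev : ∀ᶠ ε in nhdsWithin (0 : ℝ) (Set.Ioi 0),
      (∀ i : L, 0 ≤ B.coord i (AffineMap.lineMap c a ε)) ∧ 0 < ε ∧ ε < 1 := by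
    refine Filter.Eventually.and (Filter.eventually_all.mpr fun i => ?_)
      (Filter.Eventually.and self_mem_nhdsWithin
        (nhdsWithin_le_nhds (Iio_mem_nhds one_pos)))
    by_cases hi : i = ib
    · subst hi
      filter_upwards [self_mem_nhdsWithin] with ε hε
      rw [AffineMap.apply_lineMap, hcb, AffineMap.lineMap_apply]
      simpa using mul_nonneg (le_of_lt hε) hapos.le
    · have hcont : Continuous fun ε : ℝ => B.coord i (AffineMap.lineMap c a ε) := by
        simp only [AffineMap.apply_lineMap]
        exact AffineMap.lineMap_continuous
      have h0 : 0 < B.coord i (AffineMap.lineMap c a (0 : ℝ)) := by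
        simpa using hcpos i hi
      exact nhdsWithin_le_nhds ((hcont.continuousAt.eventually (lt_mem_nhds h0)).mono
        fun _ h => h.le)
  obtain ⟨ε, hε, hε0, hε1⟩ := hev.exists
  have hzL : AffineMap.lineMap c a ε ∈ convexHull ℝ ((insert b F : Finset (Euc d)) : Set (Euc d)) := by
    have h := B.convexHull_eq_nonneg_coord
    have hr : Set.range B = ((insert b F : Finset (Euc d)) : Set (Euc d)) := by
      exact Subtype.range_coe
    rw [hr] at h
    rw [h]
    exact hε
  have hzK : AffineMap.lineMap c a ε ∈ convexHull ℝ ((insert a F : Finset (Euc d)) : Set (Euc d)) :=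
    (convex_convexHull ℝ _).lineMap_mem (convexHull_mono (Finset.coe_subset.mpr hFK) hcF)
      (subset_convexHull ℝ _ (Finset.mem_coe.mpr (Finset.mem_insert_self a F))) ⟨hε0.le, hε1.le⟩
  have hz := hplane _ (hinter ⟨hzK, hzL⟩)
  have hzc : AffineMap.lineMap c a ε - x = (1 - ε) • (c - x) + ε • (a - x) := by
    rw [AffineMap.lineMap_apply_module]
    module
  rw [hzc, inner_add_right, inner_smul_right, inner_smul_right, hplane c hcF] at hz
  nlinarith

end Combinatorics

/-! ### Outward normals of cells, and sums over cell facets sorted by faces -/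

section Normals

variable {d : ℕ} {Ω : Set (Euc d)} {T : Mesh Ω} (N : FaceNormals T)

theorem FaceNormals.normal_ne_zero {F : Finset (Euc d)} (hF : F ∈ T.skel) : N.normal F ≠ 0 := by
  intro h
  have := N.norm_normal F hF
  simp [h] at this

open Classical in
/-- The side of `F` not occupied by `K⁺` contains the other cells at `F`. -/
theorem FaceNormals.inner_pos {F : Finset (Euc d)} {b x : Euc d} (hF : F ∈ T.skel) (hbF : b ∉ F)
    (hL : insert b F ∈ T.cells) (hne : insert b F ≠ N.plus F) (hx : x ∈ F) :
    0 < inner ℝ (N.normal F) (b - x) := by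
  obtain ⟨hp, hFp⟩ := N.plus_mem F hF
  obtain ⟨a, haF, hap⟩ := Mesh.exists_eq_insert hp hF hFp
  have hort : ∀ y ∈ F, inner ℝ (N.normal F) (y - x) = 0 :=
    fun y hy => N.normal_orthogonal F hF x hx y hy
  have ha : inner ℝ (N.normal F) (a - x) < 0 :=
    N.normal_outward F hF x hx a (hap ▸ Finset.mem_insert_self a F) haF
  rcases lt_or_gt_of_ne (Mesh.inner_ne_zero hL (N.normal_ne_zero hF) hort) with h | h
  · have := Mesh.opposite_eq_of_same_side haF hbF (hap ▸ hp) hL hx hort ha h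
    exact (hne (by rw [← this, hap])).elim
  · exact h

/-- A third cell would lie on the same side of `F` as `K⁻`, hence coincide with it. -/
theorem FaceNormals.eq_plus_or_minus (hd : 0 < d) {F K : Finset (Euc d)} (hF : F ∈ T.intFaces)
    (hK : K ∈ T.cells) (hFK : F ⊆ K) : K = N.plus F ∨ K = N.minus F := by
  classical
  by_contra! hne
  have hFs := (Mesh.mem_intFaces.mp hF).1
  obtain ⟨x, hx⟩ := Finset.card_pos.mp ((Mesh.mem_skel.mp hFs).2 ▸ hd)
  obtain ⟨hm, hFm, hmp⟩ := N.minus_mem F hF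
  obtain ⟨a, haF, haK⟩ := Mesh.exists_eq_insert hK hFs hFK
  obtain ⟨b, hbF, hbm⟩ := Mesh.exists_eq_insert hm hFs hFm
  have ha := N.inner_pos hFs haF (haK ▸ hK) (haK ▸ hne.1) hx
  have hb := N.inner_pos hFs hbF (hbm ▸ hm) (hbm ▸ hmp) hx
  have := Mesh.opposite_eq_of_same_side (ν := -N.normal F) haF hbF (haK ▸ hK) (hbm ▸ hm) hx
    (fun y hy => by rw [inner_neg_left, N.normal_orthogonal F hFs x hx y hy, neg_zero])
    (by rw [inner_neg_left]; linarith) (by rw [inner_neg_left]; linarith)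
  exact hne.2 (by rw [← haK, ← hbm, this])

open Classical in
/-- The normal to the face `F` of the cell `K` pointing out of `K`. -/
def FaceNormals.cellNormal (K F : Finset (Euc d)) : Euc d :=
  if K = N.plus F then N.normal F else -N.normal F

open Classical in
theorem FaceNormals.isOutwardNormal_cellNormal (hd : 0 < d) {K : Finset (Euc d)}
    (hK : K ∈ T.cells) : IsOutwardNormal K fun a => N.cellNormal K (K.erase a) where
  norm_eq_one a ha := by
    have := N.norm_normal _ (Mesh.erase_mem_skel hd hK ha)
    unfold cellNormal
    split_ifs <;> simpa
  orthogonal a ha x hx y hy := by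
    have := N.normal_orthogonal _ (Mesh.erase_mem_skel hd hK ha) x hx y hy
    unfold cellNormal
    split_ifs <;> simpa
  outward a ha x hx := by
    have hF := Mesh.erase_mem_skel hd hK ha
    unfold cellNormal
    split_ifs with h
    · exact N.normal_outward _ hF x hx a (h ▸ ha) (Finset.notMem_erase a K)
    · have := N.inner_pos hF (Finset.notMem_erase a K) (by rwa [Finset.insert_erase ha])
        (by rwa [Finset.insert_erase ha]) hx
      rw [inner_neg_left]
      linarith

-- Double counting: deleting a vertex is a bijection from the vertices of a cell to its facets.
open Classical in
theorem Mesh.sum_cells_faces (hd : 0 < d) (Φ : Finset (Euc d) → Finset (Euc d) → ℝ) :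
    ∑ K ∈ T.cells, ∑ a ∈ K, Φ K (K.erase a) =
      ∑ F ∈ T.skel, ∑ K ∈ T.cells with F ⊆ K, Φ K F := by
  have h1 : ∀ K ∈ T.cells, ∑ a ∈ K, Φ K (K.erase a) = ∑ F ∈ T.skel with F ⊆ K, Φ K F := by
    intro K hK
    refine Finset.sum_bij (fun a _ => K.erase a) ?_ ?_ ?_ fun _ _ => rfl
    · intro a ha
      exact Finset.mem_filter.mpr ⟨Mesh.erase_mem_skel hd hK ha, K.erase_subset a⟩
    · intro a ha b hb h
      by_contra hab
      have : a ∈ K.erase b := Finset.mem_erase.mpr ⟨hab, ha⟩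
      rw [← h] at this
      exact Finset.notMem_erase a K this
    · intro F hF
      obtain ⟨hFs, hFK⟩ := Finset.mem_filter.mp hF
      obtain ⟨a, haF, rfl⟩ := Mesh.exists_eq_insert hK hFs hFK
      exact ⟨a, Finset.mem_insert_self a F, Finset.erase_insert haF⟩
  rw [Finset.sum_congr rfl h1]
  simp_rw [Finset.sum_filter]
  exact Finset.sum_comm

open Classical in
theorem FaceNormals.sum_cells_faces (hd : 0 < d) (Φ : Finset (Euc d) → Finset (Euc d) → ℝ) :
    ∑ K ∈ T.cells, ∑ a ∈ K, Φ K (K.erase a) =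
      ∑ F ∈ T.intFaces, (Φ (N.plus F) F + Φ (N.minus F) F) +
        ∑ F ∈ T.bdryFaces, Φ (N.plus F) F := by
  rw [Mesh.sum_cells_faces hd, Mesh.skel_eq_union,
    Finset.sum_union Mesh.disjoint_intFaces_bdryFaces]
  congr 1
  · refine Finset.sum_congr rfl fun F hF => ?_
    obtain ⟨hp, hFp⟩ := N.plus_mem F (Mesh.mem_intFaces.mp hF).1
    obtain ⟨hm, hFm, hmp⟩ := N.minus_mem F hF
    have : T.cells.filter (F ⊆ ·) = {N.plus F, N.minus F} := by
      ext K
      simp only [Finset.mem_filter, Finset.mem_insert, Finset.mem_singleton]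
      refine ⟨fun h => N.eq_plus_or_minus hd hF h.1 h.2, ?_⟩
      rintro (rfl | rfl)
      exacts [⟨hp, hFp⟩, ⟨hm, hFm⟩]
    rw [this, Finset.sum_pair hmp.symm]
  · refine Finset.sum_congr rfl fun F hF => ?_
    obtain ⟨hFs, L, -, hL⟩ := Mesh.mem_bdryFaces.mp hF
    have : T.cells.filter (F ⊆ ·) = {N.plus F} := by
      ext K
      simp only [Finset.mem_filter, Finset.mem_singleton]
      refine ⟨fun h => (hL K h).trans (hL _ (N.plus_mem F hFs)).symm, ?_⟩
      rintro rfl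
      exact N.plus_mem F hFs
    rw [this, Finset.sum_singleton]

end Normals

/-! ### The convective forms on the diagonal -/

theorem contDiff_mvPolynomial_eval {d : ℕ} (p : MvPolynomial (Fin d) ℝ) :
    ContDiff ℝ 1 fun x : Euc d => MvPolynomial.eval (fun l => x l) p := by
  induction p using MvPolynomial.induction_on with
  | C a => simpa using contDiff_const
  | add p q hp hq => simpa using hp.add hq
  | mul_X p i hp =>
    have h : ContDiff ℝ 1 fun x : Euc d => x i := by fun_prop
    simpa using hp.mul h

/-- The default value `0` is smooth too, so no assumption on `v` is needed. -/
theorem contDiff_piece {d : ℕ} (v : Euc d → Euc d) (K : Finset (Euc d)) :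
    ContDiff ℝ 1 (piece v K) := by
  unfold piece
  split_ifs with h
  · obtain ⟨⟨j, p, -, hp⟩, -⟩ := h.choose_spec
    refine contDiff_euclidean.mpr fun i => ?_
    simp_rw [hp]
    exact contDiff_mvPolynomial_eval (p i)
  · exact contDiff_const

/-- The product rule for `|p|²p`; it explains the coefficient `½` of the divergence term. -/
theorem divergence_inner_self_smul {d : ℕ} {p : Euc d → Euc d} {x : Euc d}
    (hp : DifferentiableAt ℝ p x) :
    divergence (fun x => (inner ℝ (p x) (p x) : ℝ) • p x) x =
      2 * (inner ℝ (fderiv ℝ p x (p x)) (p x) + 1 / 2 * inner ℝ (divergence p x • p x) (p x)) := by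
  have h := (hp.hasFDerivAt.inner ℝ hp.hasFDerivAt).smul hp.hasFDerivAt
  have h2 : p x = ∑ i, p x i • EuclideanSpace.single i (1 : ℝ) := by
    ext j
    simp [Finset.sum_apply, Pi.single_apply]
  have h3 : ∑ i, inner ℝ (p x) (fderiv ℝ p x (EuclideanSpace.single i 1)) * p x i =
      inner ℝ (fderiv ℝ p x (p x)) (p x) := by
    rw [real_inner_comm]
    conv_rhs => rw [h2, map_sum, ← h2, inner_sum]
    simp only [map_smul, inner_smul_right]
    exact Finset.sum_congr rfl fun i _ => mul_comm _ _
  rw [inner_smul_left, ← h3]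
  simp only [divergence]
  have h4 : fderiv ℝ (fun x => (inner ℝ (p x) (p x) : ℝ) • p x) x = _ := h.fderiv
  rw [h4]
  simp [← Finset.sum_add_distrib, real_inner_comm, Finset.mul_sum, add_mul, Finset.sum_mul]
  refine Finset.sum_congr rfl fun i _ => ?_
  ring

section Forms

variable {n : ℕ} {Ω : Set (Euc (n + 1))} {T : Mesh Ω} (N : FaceNormals T)

theorem FaceNormals.integrableOn_face (N : FaceNormals T) {F : Finset (Euc (n + 1))} (hF : F ∈ T.skel)
    {f : Euc (n + 1) → ℝ} (hf : Continuous f) :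
    IntegrableOn f (convexHull ℝ (F : Set (Euc (n + 1)))) μHE[n] :=
  integrableOn_convexHull_facet (T.indep (Mesh.mem_skel.mp hF).1) (Mesh.mem_skel.mp hF).2
    (N.norm_normal F hF) (N.normal_orthogonal F hF) hf

/-- The flux `∫_F (v|_K · n_F) |v|_K|²`. -/
def FaceNormals.cubicFlux (v : Euc (n + 1) → Euc (n + 1)) (K F : Finset (Euc (n + 1))) : ℝ :=
  ∫ x in convexHull ℝ (F : Set (Euc (n + 1))),
    inner ℝ (piece v K x) (piece v K x) * inner ℝ (piece v K x) (N.normal F) ∂μHE[n]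

theorem continuous_cubicFlux (v : Euc (n + 1) → Euc (n + 1))
    (K : Finset (Euc (n + 1))) (w : Euc (n + 1)) : Continuous fun x =>
    (inner ℝ (piece v K x) (piece v K x) * inner ℝ (piece v K x) w : ℝ) := by
  have h := (contDiff_piece v K).continuous
  fun_prop

-- The divergence theorem for `|v|²v` on each cell. The minus sign appears because `n_F` points into
-- `K⁻`.
open Classical in
theorem convTerm_add_divTerm (v : Euc (n + 1) → Euc (n + 1)) :
    convTerm T v v v + 1 / 2 * divTerm T v v v =
      1 / 2 * (∑ F ∈ T.intFaces, (N.cubicFlux v (N.plus F) F - N.cubicFlux v (N.minus F) F) +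
        ∑ F ∈ T.bdryFaces, N.cubicFlux v (N.plus F) F) := by
  let Φ : Finset (Euc (n + 1)) → Finset (Euc (n + 1)) → ℝ := fun K F =>
    ∫ x in convexHull ℝ (F : Set (Euc (n + 1))),
      inner ℝ ((inner ℝ (piece v K x) (piece v K x) : ℝ) • piece v K x) (N.cellNormal K F) ∂μHE[n]
  have hcell : ∀ K ∈ T.cells,
      (∫ x in convexHull ℝ (K : Set (Euc (n + 1))),
        inner ℝ (fderiv ℝ (piece v K) x (piece v K x)) (piece v K x)) +
      1 / 2 * (∫ x in convexHull ℝ (K : Set (Euc (n + 1))),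
        inner ℝ (divergence (piece v K) x • piece v K x) (piece v K x)) =
      1 / 2 * ∑ a ∈ K, Φ K (K.erase a) := by
    intro K hK
    have hs := contDiff_piece v K
    have hc := hs.continuous
    have hc' := hs.continuous_fderiv one_ne_zero
    have hcomp := isCompact_convexHull_finset K
    have hdiv := integral_divergence_simplex (Mesh.affineIndependent_cell hK)
      (Mesh.mem_cells.mp hK).2 (N.isOutwardNormal_cellNormal n.succ_pos hK)
      (g := fun x => (inner ℝ (piece v K x) (piece v K x) : ℝ) • piece v K x)
      ((hs.inner ℝ hs).smul hs)
    simp only [Φ]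
    rw [← hdiv]
    simp_rw [fun x => divergence_inner_self_smul (hs.differentiable one_ne_zero x)]
    rw [integral_const_mul, integral_add, integral_const_mul]
    · ring
    · exact (Continuous.continuousOn (by fun_prop)).integrableOn_compact hcomp
    · refine Integrable.const_mul ?_ _
      refine (Continuous.continuousOn ?_).integrableOn_compact hcomp
      unfold divergence
      fun_prop
  have hsum : convTerm T v v v + 1 / 2 * divTerm T v v v =
      1 / 2 * ∑ K ∈ T.cells, ∑ a ∈ K, Φ K (K.erase a) := by
    simp only [convTerm, divTerm, cellInner]
    rw [Finset.mul_sum, Finset.mul_sum, ← Finset.sum_add_distrib]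
    exact Finset.sum_congr rfl hcell
  have hplus : ∀ F, Φ (N.plus F) F = N.cubicFlux v (N.plus F) F := by
    intro F
    simp only [Φ, FaceNormals.cellNormal, if_true, FaceNormals.cubicFlux, real_inner_smul_left]
  have hminus : ∀ F ∈ T.intFaces, Φ (N.minus F) F = -N.cubicFlux v (N.minus F) F := by
    intro F hF
    simp only [Φ, FaceNormals.cellNormal, if_neg (N.minus_mem F hF).2.2, FaceNormals.cubicFlux,
      real_inner_smul_left, inner_neg_right, mul_neg, integral_neg]
  rw [hsum, N.sum_cells_faces n.succ_pos]
  congr 2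
  · refine Finset.sum_congr rfl fun F hF => ?_
    rw [hplus, hminus F hF, sub_eq_add_neg]
  · exact Finset.sum_congr rfl fun F _ => hplus F

/-- Pointwise, with `a = v⁺` and `b = v⁻`: `¼((a+b)·n)(|a|²-|b|²) + ¼((a-b)·n)(|a|²+|b|²) = ½(|a|²
a·n - |b|² b·n)`. -/
theorem fluxTerm_add_jumpTerm (v : Euc (n + 1) → Euc (n + 1)) :
    fluxTerm N v v v + 1 / 2 * jumpTerm N v v v =
      1 / 2 * ∑ F ∈ T.intFaces, (N.cubicFlux v (N.plus F) F - N.cubicFlux v (N.minus F) F) := by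
  simp only [fluxTerm, jumpTerm, Finset.mul_sum]
  rw [← Finset.sum_add_distrib]
  refine Finset.sum_congr rfl fun F hF => ?_
  have hFs := (Mesh.mem_intFaces.mp hF).1
  have hp := (contDiff_piece v (N.plus F)).continuous
  have hm := (contDiff_piece v (N.minus F)).continuous
  simp only [faceInner, jump, avg, if_pos hF, FaceNormals.cubicFlux, add_tsub_cancel_right]
  rw [← integral_const_mul, ← integral_add, ← integral_sub, ← integral_const_mul]
  · congr 1
    funext x
    simp only [inner_add_left, inner_add_right, inner_sub_left,
      real_inner_smul_left, real_inner_smul_right, smul_eq_mul, RCLike.inner_apply, conj_trivial,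
      real_inner_comm (piece v (N.plus F) x) (piece v (N.minus F) x)]
    ring
  · exact N.integrableOn_face hFs (continuous_cubicFlux v _ _)
  · exact N.integrableOn_face hFs (continuous_cubicFlux v _ _)
  · exact N.integrableOn_face hFs (by fun_prop)
  · exact (N.integrableOn_face hFs (by fun_prop)).const_mul _

/-- Stated for a subset of the faces: part (a) keeps the boundary contribution apart, part (b) uses
all faces. -/
theorem upwindTerm_nonneg {ζ : Finset (Euc (n + 1)) → ℝ} (hζ : ∀ F ∈ T.skel, 0 ≤ ζ F)
    (v : Euc (n + 1) → Euc (n + 1)) (S : Finset (Finset (Euc (n + 1)))) (hS : S ⊆ T.skel) :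
    0 ≤ ∑ F ∈ S, faceInner F
      (fun x => (ζ F * |inner ℝ (avg N (piece v) F x) (N.normal F)|) • jump N (piece v) F x)
      (jump N (piece v) F) := by
  refine Finset.sum_nonneg fun F hF => integral_nonneg fun x => ?_
  simp only [Pi.zero_apply, real_inner_smul_left]
  exact mul_nonneg (mul_nonneg (hζ F (hS hF)) (abs_nonneg _)) real_inner_self_nonneg

theorem c1_self (ζ : Finset (Euc (n + 1)) → ℝ) (θ : ℝ) (v : Euc (n + 1) → Euc (n + 1)) :
    c1 T N ζ θ v v = c2 T N ζ θ v v := by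
  unfold c1 c2
  ring

/-- On the diagonal, only the boundary fluxes and the upwind term survive. -/
theorem c2_self (ζ : Finset (Euc (n + 1)) → ℝ) (θ : ℝ) (v : Euc (n + 1) → Euc (n + 1)) :
    c2 T N ζ θ v v = (1 - θ) / 2 * ∑ F ∈ T.bdryFaces, N.cubicFlux v (N.plus F) F +
      upwindTerm N ζ v v v := by
  have h1 := convTerm_add_divTerm N v
  have h2 := fluxTerm_add_jumpTerm N v
  unfold c2
  -- The interior fluxes in `h1` and `h2` cancel.
  linear_combination (1 - θ) * (h1 - h2)

theorem c2_self_nonneg_of_bdry_flux_eq_zero {ζ : Finset (Euc (n + 1)) → ℝ}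
    (hζ : ∀ F ∈ T.skel, 0 ≤ ζ F) (θ : ℝ) {v : Euc (n + 1) → Euc (n + 1)}
    (hv : ∀ F ∈ T.bdryFaces, ∀ x ∈ convexHull ℝ (F : Set (Euc (n + 1))),
      inner ℝ (piece v (N.plus F) x) (N.normal F) = 0) : 0 ≤ c2 T N ζ θ v v := by
  rw [c2_self, Finset.sum_eq_zero, mul_zero, zero_add]
  · exact upwindTerm_nonneg N hζ v _ subset_rfl
  · intro F hF
    refine setIntegral_eq_zero_of_forall_eq_zero fun x hx => ?_
    rw [hv F hF x hx, mul_zero]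

/-- On a boundary face jump and average are both the trace. With `s = v·n` the integrand is `(½(1 -
θ)s + ζ|s|)|v|²`, which is non-negative for `ζ ≥ ½|1 - θ|`. -/
theorem c2_self_nonneg_of_upwind {ζ : Finset (Euc (n + 1)) → ℝ} (hζ : ∀ F ∈ T.skel, 0 ≤ ζ F)
    {θ : ℝ} (hθ : ∀ F ∈ T.bdryFaces, 1 / 2 * |1 - θ| ≤ ζ F) (v : Euc (n + 1) → Euc (n + 1)) :
    0 ≤ c2 T N ζ θ v v := by
  classical
  rw [c2_self, upwindTerm]
  rw [Mesh.skel_eq_union, Finset.sum_union Mesh.disjoint_intFaces_bdryFaces, add_left_comm, Finset.mul_sum,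
    ← Finset.sum_add_distrib]
  refine add_nonneg (upwindTerm_nonneg N hζ v _
    fun F hF => (Mesh.mem_intFaces.mp hF).1) (Finset.sum_nonneg fun F hF => ?_)
  obtain ⟨hFs, hFi⟩ := Mesh.mem_bdryFaces_iff.mp hF
  have hp := (contDiff_piece v (N.plus F)).continuous
  simp only [faceInner, jump, avg, if_neg hFi, FaceNormals.cubicFlux, add_tsub_cancel_right]
  rw [← integral_const_mul, ← integral_add]
  · refine integral_nonneg fun x => ?_
    simp only [Pi.zero_apply, real_inner_smul_left]
    set s : ℝ := inner ℝ (piece v (N.plus F) x) (N.normal F)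
    have hq : (0 : ℝ) ≤ inner ℝ (piece v (N.plus F) x) (piece v (N.plus F) x) :=
      real_inner_self_nonneg
    have h1 : 1 / 2 * |1 - θ| * |s| ≤ ζ F * |s| :=
      mul_le_mul_of_nonneg_right (hθ F hF) (abs_nonneg s)
    have h2 : -(|1 - θ| * |s|) ≤ (1 - θ) * s := by
      rw [← abs_mul]; exact neg_abs_le _
    nlinarith [mul_nonneg (sub_nonneg.mpr h1) hq, mul_nonneg (sub_nonneg.mpr h2) hq]
  · exact (N.integrableOn_face hFs (continuous_cubicFlux v _ _)).const_mul _
  · exact N.integrableOn_face hFs (by fun_prop)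

end Forms

end DG

end

theorem lemma1 (d : ℕ) (hd : d = 2 ∨ d = 3) (Ω : Set (Euc d)) (hΩ : DG.IsPolyhedralDomain Ω)
    (T : DG.Mesh Ω) (N : DG.FaceNormals T) (k : ℕ) (θ : ℝ)
    (ζ : Finset (Euc d) → ℝ) (hζ : ∀ F ∈ T.skel, 0 ≤ ζ F) :
    ((∀ F ∈ T.bdryFaces, 1 / 2 * |1 - θ| ≤ ζ F) → ∀ v ∈ DG.Vh T k,
      DG.c1 T N ζ θ v v = DG.c2 T N ζ θ v v ∧ 0 ≤ DG.c2 T N ζ θ v v) ∧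
    (∀ fam : DG.Family, ∀ v ∈ DG.VhDiv T N fam k,
      DG.c1 T N ζ θ v v = DG.c2 T N ζ θ v v ∧ 0 ≤ DG.c2 T N ζ θ v v) := by
  -- Writing `d = n + 1` makes the face dimension `d - 1` equal to `n`.
  obtain ⟨n, rfl⟩ : ∃ n, d = n + 1 := ⟨d - 1, by omega⟩
  exact ⟨fun hθ v _ => ⟨DG.c1_self N ζ θ v, DG.c2_self_nonneg_of_upwind N hζ hθ v⟩,
    fun _ v hv => ⟨DG.c1_self N ζ θ v,
      DG.c2_self_nonneg_of_bdry_flux_eq_zero N hζ θ hv.2.2⟩⟩
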